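/- **Conventions.** Let $k$ be a commutative ring; all algebras are associative and unital $k$-algebras, not necessarily commutative. A *right bialgebroid* $\mathcal H_R$ over an algebra $R$ consists of an algebra $H$, algebra maps $s_R:R\to H$, $t_R:R^{op}\to H$ with commuting ranges, and an $R$-coring structure $(\Delta_R,\varepsilon_R)$ on $H$ with $R$-bimodule structure $r\cdot h\cdot r'=h\,s_R(r')t_R(r)$, written $\Delta_R(h)=h^{(1)}\otimes_R h^{(2)}$, such that $s_R(r)h^{(1)}\otimes_R h^{(2)}=h^{(1)}\otimes_R t_R(r)h^{(2)}$, $\Delta_R$ is unital and multiplicative, $\varepsilon_R(1_H)=1_R$ and $\varepsilon_R(s_R(\varepsilon_R(h))h')=\varepsilon_R(hh')$. A *left bialgebroid* $\mathcal H_L$ over $L$ is the opposite notion: algebra maps $s_L:L\to H$, $t_L:L^{op}\to H$ with commuting ranges and an $L$-coring structure $\Delta_L(h)=h_{(1)}\otimes_L h_{(2)}$, $\varepsilon_L$ with $L$-bimodule structure $l\cdot h\cdot l'=s_L(l)t_L(l')h$, such that $h_{(1)}t_L(l)\otimes_L h_{(2)}=h_{(1)}\otimes_L h_{(2)}s_L(l)$,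 $\Delta_L$ is unital and multiplicative, $\varepsilon_L(1_H)=1_L$ and $\varepsilon_L(h\,t_L(\varepsilon_L(h')))=\varepsilon_L(hh')$. A *Hopf algebroid* $\mathcal H$ consists of a left bialgebroid $\mathcal H_L$ over $L$ and a right bialgebroid $\mathcal H_R$ over $R$ on the same algebra $H$, and a $k$-linear map $S:H\to H$ (the antipode), such that 1. $s_L\varepsilon_Lt_R=t_R$, $t_L\varepsilon_Ls_R=s_R$, $s_R\varepsilon_Rt_L=t_L$, $t_R\varepsilon_Rs_L=s_L$; 2. $(\Delta_L\otimes_R H)\Delta_R=(H\otimes_L\Delta_R)\Delta_L$ and $(\Delta_R\otimes_L H)\Delta_L=(H\otimes_R\Delta_L)\Delta_R$; 3. $S(t_L(l)\,h\,t_R(r))=s_R(r)S(h)s_L(l)$; 4. $S(h_{(1)})h_{(2)}=s_R(\varepsilon_R(h))$ and $h^{(1)}S(h^{(2)})=s_L(\varepsilon_L(h))$. No purity (or flatness) assumption is made. A *right $\mathcal H$-comodule* is a $k$-module $M$ with right $R$- and $L$-module structures, a coaction $m\mapsto m^{(0)}\otimes_R m^{(1)}$ of the $R$-coring $(H,\Delta_R,\varepsilon_R)$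 and a coaction $m\mapsto m_{(0)}\otimes_L m_{(1)}$ of the $L$-coring $(H,\Delta_L,\varepsilon_L)$, such that the first coaction is right $L$-linear (for $h\cdot l=t_L(l)h$ on $H$), the second is right $R$-linear (for $h\cdot r=h\,s_R(r)$ on $H$), and $$m_{(0)}{}^{(0)}\otimes_R m_{(0)}{}^{(1)}\otimes_L m_{(1)}=m^{(0)}\otimes_R m^{(1)}{}_{(1)}\otimes_L m^{(1)}{}_{(2)},\qquad m^{(0)}{}_{(0)}\otimes_L m^{(0)}{}_{(1)}\otimes_R m^{(1)}=m_{(0)}\otimes_L m_{(1)}{}^{(1)}\otimes_R m_{(1)}{}^{(2)}.$$ Morphisms are the maps that are linear over $R$ and $L$ and commute with both coactions; the category is the monoidal category $\mathcal M^{\mathcal H}$. The algebra $H$ is an object of it via $\Delta_R$ and $\Delta_L$. A *right $\mathcal H$-comodule algebra* is a monoid $A$ in $\mathcal M^{\mathcal H}$; thus $A$ is an algebra with an algebra map $\eta_R:R\to A$ that induces the $R$-actions on $A$, and both coactions are unital and multiplicative. Its coinvariant subalgebra is $B=A^{co\mathcal H_R}=\{b\in A: b^{(0)}\otimes_R b^{(1)}=b\otimes_R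 1_H\}$. The extension $B\subseteq A$ is *$\mathcal H$-cleft* if there are an algebra map $\eta_L:L\to A$ with range in $B$, a left $L$-linear map $j:H\to A$ of right $\mathcal H$-comodules (i.e. $j(s_L(l)h)=\eta_L(l)j(h)$; a *cleaving map*), and a $k$-linear map $\tilde j:H\to A$ (its *inverse*) with $\tilde j(h\,t_R(r))=\eta_R(r)\tilde j(h)$, $\tilde j(t_L(l)h)=\tilde j(h)\eta_L(l)$ and $$j(h^{(1)})\,\tilde j(h^{(2)})=\eta_L(\varepsilon_L(h)),\qquad \tilde j(h_{(1)})\,j(h_{(2)})=\eta_R(\varepsilon_R(h)).$$ A *right-right relative Hopf module* is a right $A$-module $M$ in $\mathcal M^{\mathcal H}$; the category of these, with $A$-linear comodule maps, is $\mathcal M^{\mathcal H}_A$. For such $M$, $M^{co\mathcal H_R}=\{n\in M:n^{(0)}\otimes_R n^{(1)}=n\otimes_R 1_H\}$ is a right $B$-module. **Theorem.** Let $\mathcal H$ be any Hopf algebroid and let $A$ be a right $\mathcal H$-comodule algebra, with $B=A^{co\mathcal H_R}$, such that $B\subseteq A$ is $\mathcal H$-cleft. Then the induction functor $-\otimes_B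 A:\mathcal M_B\to\mathcal M^{\mathcal H}_A$ (with the $A$-action and the two coactions on the second factor) is an equivalence of categories. It is left adjoint to the coinvariants functor $(-)^{co\mathcal H_R}:\mathcal M^{\mathcal H}_A\to\mathcal M_B$, by an adjunction with unit and counit $$e_W:W\to(W\otimes_B A)^{co\mathcal H_R},\ w\mapsto w\otimes_B 1_A,\qquad c_M:M^{co\mathcal H_R}\otimes_B A\to M,\ n\otimes_B a\mapsto na,$$ which are natural isomorphisms. Moreover, for any cleaving map $j$ with inverse $\tilde j$ (with respect to any $\eta_L$): * for every $M\in\mathcal M^{\mathcal H}_A$ and $m\in M$, the element $m^{(0)}\tilde j(m^{(1)})$ lies in $M^{co\mathcal H_R}$, and $$c_M^{-1}(m)=m_{(0)}{}^{(0)}\,\tilde j\big(m_{(0)}{}^{(1)}\big)\otimes_B j(m_{(1)});$$ * for every $a\in A$, the element $a^{(0)}\tilde j(a^{(1)})j(1_H)$ lies in $B$, and for every $W\in\mathcal M_B$ and $\sum_i w_i\otimes_B a_i\in(W\otimes_B A)^{co\mathcal H_R}$, $$e_W^{-1}\Big(\sum_i w_i\otimes_B a_i\Big)=\sum_i w_i\,a_i^{(0)}\,\tilde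 j\big(a_i^{(1)}\big)\,j(1_H).$$ -/

import Mathlib

open CategoryTheory TensorProduct MulOpposite

universe v u

namespace HopfAlgd

/-! ### Tensor products over noncommutative algebras

A right (left) module structure over a `k`-algebra `Q` on a `k`-module `M` is given by an algebra
homomorphism `Qᵐᵒᵖ →ₐ[k] Module.End k M` (`Q →ₐ[k] Module.End k M`).  This keeps apart the several
module structures that live on the total algebra of a Hopf algebroid. -/

section Balanced

variable {k Q M N : Type*} [CommRing k] [Ring Q] [Algebra k Q]
  [AddCommGroup M] [Module k M] [AddCommGroup N] [Module k N]

/-- The relations `m q ⊗ n = m ⊗ q n`. -/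
def balRel (ρ : Qᵐᵒᵖ →ₐ[k] Module.End k M) (l : Q →ₐ[k] Module.End k N) :
    Submodule k (M ⊗[k] N) :=
  Submodule.span k {x | ∃ (q : Q) (m : M) (n : N), x = ρ (op q) m ⊗ₜ[k] n - m ⊗ₜ[k] l q n}

/-- The tensor product `M ⊗_Q N` of a right `Q`-module `M` and a left `Q`-module `N`, as a
quotient of `M ⊗_k N`. -/
abbrev Bal (ρ : Qᵐᵒᵖ →ₐ[k] Module.End k M) (l : Q →ₐ[k] Module.End k N) : Type _ :=
  (M ⊗[k] N) ⧸ balRel ρ l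

/-- The projection `M ⊗_k N → M ⊗_Q N`.  An element `x` with `Bal.mk ρ l x = y` is called a
representative of `y`; choosing a representative is what Sweedler's index notation does. -/
def Bal.mk (ρ : Qᵐᵒᵖ →ₐ[k] Module.End k M) (l : Q →ₐ[k] Module.End k N) :
    M ⊗[k] N →ₗ[k] Bal ρ l :=
  (balRel ρ l).mkQ

variable {ρ : Qᵐᵒᵖ →ₐ[k] Module.End k M} {l : Q →ₐ[k] Module.End k N}

theorem Bal.mk_surjective : Function.Surjective (Bal.mk ρ l) :=
  (balRel ρ l).mkQ_surjective

theorem Bal.mk_balanced (q : Q) (m : M) (n : N) :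
    Bal.mk ρ l (ρ (op q) m ⊗ₜ n) = Bal.mk ρ l (m ⊗ₜ l q n) := by
  rw [← sub_eq_zero, ← map_sub]
  exact (Submodule.Quotient.mk_eq_zero _).2 (Submodule.subset_span ⟨q, m, n, rfl⟩)

/-- A `k`-linear map on `M ⊗_k N` that is `Q`-balanced descends to `M ⊗_Q N`. -/
def Bal.lift {Z : Type*} [AddCommGroup Z] [Module k Z] (f : M ⊗[k] N →ₗ[k] Z)
    (hf : ∀ (q : Q) (m : M) (n : N), f (ρ (op q) m ⊗ₜ n) = f (m ⊗ₜ l q n)) : Bal ρ l →ₗ[k] Z :=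
  (balRel ρ l).liftQ f (by
    rw [balRel, Submodule.span_le]
    rintro _ ⟨q, m, n, rfl⟩
    simp [hf])

@[simp] theorem Bal.lift_mk {Z : Type*} [AddCommGroup Z] [Module k Z] (f : M ⊗[k] N →ₗ[k] Z)
    (hf : ∀ (q : Q) (m : M) (n : N), f (ρ (op q) m ⊗ₜ n) = f (m ⊗ₜ l q n)) (x : M ⊗[k] N) :
    Bal.lift (ρ := ρ) (l := l) f hf (Bal.mk ρ l x) = f x := rfl

end Balanced

section Triple

variable {k Q₁ Q₂ M X P : Type*} [CommRing k] [Ring Q₁] [Algebra k Q₁] [Ring Q₂] [Algebra k Q₂]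
  [AddCommGroup M] [Module k M] [AddCommGroup X] [Module k X] [AddCommGroup P] [Module k P]

/-- The relations `m q ⊗ x ⊗ p = m ⊗ q x ⊗ p` for `q ∈ Q₁` and `m ⊗ x q ⊗ p = m ⊗ x ⊗ q p` for
`q ∈ Q₂`. -/
def triRel (ρ₁ : Q₁ᵐᵒᵖ →ₐ[k] Module.End k M) (l₁ : Q₁ →ₐ[k] Module.End k X)
    (ρ₂ : Q₂ᵐᵒᵖ →ₐ[k] Module.End k X) (l₂ : Q₂ →ₐ[k] Module.End k P) :
    Submodule k (M ⊗[k] (X ⊗[k] P)) :=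
  Submodule.span k
    ({y | ∃ (q : Q₁) (m : M) (x : X) (p : P),
        y = ρ₁ (op q) m ⊗ₜ[k] (x ⊗ₜ[k] p) - m ⊗ₜ[k] (l₁ q x ⊗ₜ[k] p)} ∪
      {y | ∃ (q : Q₂) (m : M) (x : X) (p : P),
        y = m ⊗ₜ[k] (ρ₂ (op q) x ⊗ₜ[k] p) - m ⊗ₜ[k] (x ⊗ₜ[k] l₂ q p)})

/-- The tensor product `M ⊗_{Q₁} X ⊗_{Q₂} P`, as a quotient of `M ⊗_k X ⊗_k P`. -/
abbrev Tri (ρ₁ : Q₁ᵐᵒᵖ →ₐ[k] Module.End k M) (l₁ : Q₁ →ₐ[k] Module.End k X)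
    (ρ₂ : Q₂ᵐᵒᵖ →ₐ[k] Module.End k X) (l₂ : Q₂ →ₐ[k] Module.End k P) : Type _ :=
  (M ⊗[k] (X ⊗[k] P)) ⧸ triRel ρ₁ l₁ ρ₂ l₂

variable {ρ₁ : Q₁ᵐᵒᵖ →ₐ[k] Module.End k M} {l₁ : Q₁ →ₐ[k] Module.End k X}
  {ρ₂ : Q₂ᵐᵒᵖ →ₐ[k] Module.End k X} {l₂ : Q₂ →ₐ[k] Module.End k P}

/-- The map `(M ⊗_{Q₁} X) → (P → M ⊗_{Q₁} X ⊗_{Q₂} P)`, `m ⊗ x ↦ (p ↦ m ⊗ x ⊗ p)`. -/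
def Tri.joinLeft (ρ₁ : Q₁ᵐᵒᵖ →ₐ[k] Module.End k M) (l₁ : Q₁ →ₐ[k] Module.End k X)
    (ρ₂ : Q₂ᵐᵒᵖ →ₐ[k] Module.End k X) (l₂ : Q₂ →ₐ[k] Module.End k P) :
    Bal ρ₁ l₁ →ₗ[k] P →ₗ[k] Tri ρ₁ l₁ ρ₂ l₂ :=
  Bal.lift (TensorProduct.curry
      ((triRel ρ₁ l₁ ρ₂ l₂).mkQ ∘ₗ (TensorProduct.assoc k M X P).toLinearMap))
    (by
      intro q m x
      ext p
      rw [← sub_eq_zero]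
      simp only [TensorProduct.curry_apply, LinearMap.comp_apply, LinearEquiv.coe_coe,
        TensorProduct.assoc_tmul]
      rw [← map_sub]
      exact (Submodule.Quotient.mk_eq_zero _).2
        (Submodule.subset_span (Or.inl ⟨q, m, x, p, rfl⟩)))

/-- The map `(X ⊗_{Q₂} P) → (M → M ⊗_{Q₁} X ⊗_{Q₂} P)`, `x ⊗ p ↦ (m ↦ m ⊗ x ⊗ p)`. -/
def Tri.joinRight (ρ₁ : Q₁ᵐᵒᵖ →ₐ[k] Module.End k M) (l₁ : Q₁ →ₐ[k] Module.End k X)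
    (ρ₂ : Q₂ᵐᵒᵖ →ₐ[k] Module.End k X) (l₂ : Q₂ →ₐ[k] Module.End k P) :
    Bal ρ₂ l₂ →ₗ[k] M →ₗ[k] Tri ρ₁ l₁ ρ₂ l₂ :=
  Bal.lift (((TensorProduct.mk k M (X ⊗[k] P)).compr₂ (triRel ρ₁ l₁ ρ₂ l₂).mkQ).flip)
    (by
      intro q x p
      ext m
      rw [← sub_eq_zero]
      simp only [LinearMap.flip_apply, LinearMap.compr₂_apply, TensorProduct.mk_apply]
      rw [← map_sub]
      exact (Submodule.Quotient.mk_eq_zero _).2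
        (Submodule.subset_span (Or.inr ⟨q, m, x, p, rfl⟩)))

/-- For `δ : M' → M ⊗_{Q₁} X`, the map `δ ⊗ P : M' ⊗_k P → M ⊗_{Q₁} X ⊗_{Q₂} P`. -/
def Tri.mapLeft {M' : Type*} [AddCommGroup M'] [Module k M']
    (ρ₂ : Q₂ᵐᵒᵖ →ₐ[k] Module.End k X) (l₂ : Q₂ →ₐ[k] Module.End k P)
    (δ : M' →ₗ[k] Bal ρ₁ l₁) : M' ⊗[k] P →ₗ[k] Tri ρ₁ l₁ ρ₂ l₂ :=
  TensorProduct.lift (Tri.joinLeft ρ₁ l₁ ρ₂ l₂ ∘ₗ δ)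

/-- For `Δ : Y → X ⊗_{Q₂} P`, the map `M ⊗ Δ : M ⊗_k Y → M ⊗_{Q₁} X ⊗_{Q₂} P`. -/
def Tri.mapRight {Y : Type*} [AddCommGroup Y] [Module k Y]
    (ρ₁ : Q₁ᵐᵒᵖ →ₐ[k] Module.End k M) (l₁ : Q₁ →ₐ[k] Module.End k X)
    (Δ : Y →ₗ[k] Bal ρ₂ l₂) : M ⊗[k] Y →ₗ[k] Tri ρ₁ l₁ ρ₂ l₂ :=
  TensorProduct.lift ((Tri.joinRight ρ₁ l₁ ρ₂ l₂ ∘ₗ Δ).flip)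

end Triple

/-! ### Identities in Sweedler's notation

A map out of a tensor product over a noncommutative algebra is evaluated on an arbitrary
representative in the tensor product over `k`.  In every use below the map is balanced thanks to the
other axioms, so that all representatives give the same value. -/

section Sweedler

variable {k Q Q₁ Q₂ M M' N : Type*} [CommRing k] [Ring Q] [Algebra k Q]
  [Ring Q₁] [Algebra k Q₁] [Ring Q₂] [Algebra k Q₂]
  [AddCommGroup M] [Module k M] [AddCommGroup M'] [Module k M'] [AddCommGroup N] [Module k N]

/-- `δ' (f m) = (f ⊗ N) (δ m)`. -/
def Colinear {ρ : Qᵐᵒᵖ →ₐ[k] Module.End k M} {ρ' : Qᵐᵒᵖ →ₐ[k] Module.End k M'}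
    {l : Q →ₐ[k] Module.End k N} (δ : M →ₗ[k] Bal ρ l) (δ' : M' →ₗ[k] Bal ρ' l)
    (f : M →ₗ[k] M') : Prop :=
  ∀ (m : M) (x : M ⊗[k] N), Bal.mk ρ l x = δ m → δ' (f m) = Bal.mk ρ' l (f.rTensor N x)

/-- `δ (σ m) = (M ⊗ τ) (δ m)`. -/
def Intertwines {ρ : Qᵐᵒᵖ →ₐ[k] Module.End k M} {l : Q →ₐ[k] Module.End k N}
    (δ : M →ₗ[k] Bal ρ l) (σ : Module.End k M) (τ : Module.End k N) : Prop :=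
  ∀ (m : M) (x : M ⊗[k] N), Bal.mk ρ l x = δ m → δ (σ m) = Bal.mk ρ l (τ.lTensor M x)

/-- `(M ⊗_Q ε) (δ m) = m`. -/
def RightCounital {ρ : Qᵐᵒᵖ →ₐ[k] Module.End k M} {l : Q →ₐ[k] Module.End k N}
    (δ : M →ₗ[k] Bal ρ l) (ε : N →ₗ[k] Q) : Prop :=
  ∀ (m : M) (x : M ⊗[k] N), Bal.mk ρ l x = δ m →
    TensorProduct.lift
      ((ρ.toLinearMap ∘ₗ (opLinearEquiv k : Q ≃ₗ[k] Qᵐᵒᵖ).toLinearMap ∘ₗ ε).flip) x = m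

/-- `(ε ⊗_Q N) (Δ n) = n`. -/
def LeftCounital {ρ : Qᵐᵒᵖ →ₐ[k] Module.End k M} {l : Q →ₐ[k] Module.End k N}
    (δ : N →ₗ[k] Bal ρ l) (ε : M →ₗ[k] Q) : Prop :=
  ∀ (n : N) (x : M ⊗[k] N), Bal.mk ρ l x = δ n →
    TensorProduct.lift (l.toLinearMap ∘ₗ ε) x = n

/-- `(δ₁ ⊗_{Q₂} N) (δ₂ m) = (M ⊗_{Q₁} Δ) (δ₁ m)` in `M ⊗_{Q₁} N ⊗_{Q₂} N`, where
`δ₁ : M → M ⊗_{Q₁} N`, `δ₂ : M → M ⊗_{Q₂} N` and `Δ : N → N ⊗_{Q₂} N`.  For `δ₁ = δ₂` this is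
coassociativity. -/
def Coassociative {ρ₁ : Q₁ᵐᵒᵖ →ₐ[k] Module.End k M} {l₁ : Q₁ →ₐ[k] Module.End k N}
    {ρ₂ : Q₂ᵐᵒᵖ →ₐ[k] Module.End k M} {l₂ : Q₂ →ₐ[k] Module.End k N}
    {ρN : Q₂ᵐᵒᵖ →ₐ[k] Module.End k N}
    (δ₁ : M →ₗ[k] Bal ρ₁ l₁) (δ₂ : M →ₗ[k] Bal ρ₂ l₂) (Δ : N →ₗ[k] Bal ρN l₂) : Prop :=
  ∀ (m : M) (x y : M ⊗[k] N), Bal.mk ρ₂ l₂ x = δ₂ m → Bal.mk ρ₁ l₁ y = δ₁ m →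
    Tri.mapLeft ρN l₂ δ₁ x = Tri.mapRight ρ₁ l₁ Δ y

/-- `(C, Δ, ε)` is a `Q`-coring, where the left and right `Q`-actions on `C` are `l` and `ρ`. -/
structure IsCoring (l : Q →ₐ[k] Module.End k N) (ρ : Qᵐᵒᵖ →ₐ[k] Module.End k N)
    (Δ : N →ₗ[k] Bal ρ l) (ε : N →ₗ[k] Q) : Prop where
  bimodule : ∀ (q q' : Q) (c : N), ρ (op q') (l q c) = l q (ρ (op q') c)
  comul_left : ∀ q : Q, Colinear Δ Δ (l q)
  comul_right : ∀ q : Q, Intertwines Δ (ρ (op q)) (ρ (op q))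
  counit_left : ∀ (q : Q) (c : N), ε (l q c) = q * ε c
  counit_right : ∀ (q : Q) (c : N), ε (ρ (op q) c) = ε c * q
  coassoc : Coassociative Δ Δ Δ
  counital_left : LeftCounital Δ ε
  counital_right : RightCounital Δ ε

/-- `δ : M → M ⊗_Q C` is a right coaction of the `Q`-coring `(C, Δ, ε)` on the right `Q`-module
`M`. -/
structure IsCoaction {ρ : Qᵐᵒᵖ →ₐ[k] Module.End k M} {l : Q →ₐ[k] Module.End k N}
    {ρN : Qᵐᵒᵖ →ₐ[k] Module.End k N} (Δ : N →ₗ[k] Bal ρN l) (ε : N →ₗ[k] Q)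
    (δ : M →ₗ[k] Bal ρ l) : Prop where
  linear : ∀ q : Q, Intertwines δ (ρ (op q)) (ρN (op q))
  coassoc : Coassociative δ δ Δ
  counital : RightCounital δ ε

end Sweedler

/-! ### Bialgebroids and Hopf algebroids -/

section Actions

variable {k X H : Type*} [CommRing k] [Ring X] [Algebra k X] [Ring H] [Algebra k H]

/-- The action `x • h = f x * h`. -/
def lmulAct (f : X →ₐ[k] H) : X →ₐ[k] Module.End k H := (Algebra.lmul k H).comp f

/-- The right action `h • x = h * f x`. -/
def rmulActOp (f : X →ₐ[k] H) : Xᵐᵒᵖ →ₐ[k] Module.End k H :=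
  (Algebra.lsmul k k H : Hᵐᵒᵖ →ₐ[k] Module.End k H).comp (AlgHom.op f)

/-- The left action `x • h = h * f x` for an anti-homomorphism `f`. -/
def rmulAct (f : Xᵐᵒᵖ →ₐ[k] H) : X →ₐ[k] Module.End k H :=
  (Algebra.lsmul k k H : Hᵐᵒᵖ →ₐ[k] Module.End k H).comp (AlgHom.opComm.symm f)

@[simp] theorem lmulAct_apply (f : X →ₐ[k] H) (x : X) (h : H) : lmulAct f x h = f x * h := rfl

@[simp] theorem rmulActOp_apply (f : X →ₐ[k] H) (x : X) (h : H) :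
    rmulActOp f (op x) h = h * f x := rfl

@[simp] theorem rmulAct_apply (f : Xᵐᵒᵖ →ₐ[k] H) (x : X) (h : H) :
    rmulAct f x h = h * f (op x) := rfl

end Actions

/-! ### Induced actions and coactions -/

section Induction

variable {k Q Q₁ Q₂ B W A N P : Type*} [CommRing k] [Ring B] [Algebra k B]
  [Ring Q] [Algebra k Q] [Ring Q₁] [Algebra k Q₁] [Ring Q₂] [Algebra k Q₂]
  [AddCommGroup W] [Module k W] [AddCommGroup A] [Module k A] [AddCommGroup N] [Module k N]
  [AddCommGroup P] [Module k P]
  {ω : Bᵐᵒᵖ →ₐ[k] Module.End k W} {β : B →ₐ[k] Module.End k A}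

/-- The map `A → W ⊗_B A`, `a ↦ w ⊗ a`. -/
def ins (ω : Bᵐᵒᵖ →ₐ[k] Module.End k W) (β : B →ₐ[k] Module.End k A) (w : W) :
    A →ₗ[k] Bal ω β :=
  Bal.mk ω β ∘ₗ TensorProduct.mk k W A w

theorem Bal.hom_ext {Z : Type*} [AddCommGroup Z] [Module k Z] {f g : Bal ω β →ₗ[k] Z}
    (h : ∀ w a, f (ins ω β w a) = g (ins ω β w a)) : f = g := by
  refine Submodule.linearMap_qext _ (TensorProduct.ext' h)

/-- An action on `A` by left `B`-linear maps induces an action on `W ⊗_B A`. -/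
def indAct {X : Type*} [Ring X] [Algebra k X] (ω : Bᵐᵒᵖ →ₐ[k] Module.End k W)
    (β : B →ₐ[k] Module.End k A) (σ : X →ₐ[k] Module.End k A)
    (h : ∀ x b a, σ x (β b a) = β b (σ x a)) : X →ₐ[k] Module.End k (Bal ω β) :=
  AlgHom.ofLinearMap
    { toFun := fun x => Bal.lift (Bal.mk ω β ∘ₗ (σ x).lTensor W) (by
        intro q m n
        simp only [LinearMap.comp_apply, LinearMap.lTensor_tmul, h, Bal.mk_balanced])
      map_add' := fun x y => Bal.hom_ext fun w a => by
        simp [ins]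
      map_smul' := fun c x => Bal.hom_ext fun w a => by
        simp [ins] }
    (Bal.hom_ext fun w a => by simp [ins])
    (fun x y => Bal.hom_ext fun w a => by simp [ins])

@[simp] theorem indAct_ins {X : Type*} [Ring X] [Algebra k X]  (σ : X →ₐ[k] Module.End k A)
    (h : ∀ x b a, σ x (β b a) = β b (σ x a)) (x : X) (w : W) (a : A) :
    indAct ω β σ h x (ins ω β w a) = ins ω β w (σ x a) := rfl

/-- `f ⊗_Q N` for a right `Q`-linear map `f`. -/
def Bal.mapLeft {M M' : Type*} [AddCommGroup M] [Module k M] [AddCommGroup M'] [Module k M']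
    {ρ : Qᵐᵒᵖ →ₐ[k] Module.End k M} {ρ' : Qᵐᵒᵖ →ₐ[k] Module.End k M'}
    (l : Q →ₐ[k] Module.End k N) (f : M →ₗ[k] M')
    (hf : ∀ q m, f (ρ (op q) m) = ρ' (op q) (f m)) : Bal ρ l →ₗ[k] Bal ρ' l :=
  Bal.lift (Bal.mk ρ' l ∘ₗ f.rTensor N) (by
    intro q m n
    simp only [LinearMap.comp_apply, LinearMap.rTensor_tmul, hf, Bal.mk_balanced])

@[simp] theorem Bal.mapLeft_mk {M M' : Type*} [AddCommGroup M] [Module k M] [AddCommGroup M']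
    [Module k M'] {ρ : Qᵐᵒᵖ →ₐ[k] Module.End k M} {ρ' : Qᵐᵒᵖ →ₐ[k] Module.End k M'}
    (l : Q →ₐ[k] Module.End k N) (f : M →ₗ[k] M')
    (hf : ∀ q m, f (ρ (op q) m) = ρ' (op q) (f m)) (x : M ⊗[k] N) :
    Bal.mapLeft l f hf (Bal.mk ρ l x) = Bal.mk ρ' l (f.rTensor N x) := rfl

/-- The coaction `W ⊗_B δ` on `W ⊗_B A` induced by a left `B`-linear coaction `δ` on `A`. -/
def indCo (ω : Bᵐᵒᵖ →ₐ[k] Module.End k W) {ρ : Qᵐᵒᵖ →ₐ[k] Module.End k A}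
    {l : Q →ₐ[k] Module.End k N} (δ : A →ₗ[k] Bal ρ l)
    (h : ∀ x b a, ρ x (β b a) = β b (ρ x a)) (hδ : ∀ b, Colinear δ δ (β b)) :
    Bal ω β →ₗ[k] Bal (indAct ω β ρ h) l :=
  Bal.lift (TensorProduct.lift
    { toFun := fun w => Bal.mapLeft l (ins ω β w) 
        (fun q m => (indAct_ins ρ h (op q) w m).symm) ∘ₗ δ
      map_add' := fun w w' => by
        ext a
        obtain ⟨x, hx⟩ := Bal.mk_surjective (δ a)
        simp only [LinearMap.comp_apply, LinearMap.add_apply, ← hx, Bal.mapLeft_mk]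
        rw [← map_add, ← LinearMap.add_apply, ← LinearMap.rTensor_add]
        congr 3
        ext a; simp [ins]
      map_smul' := fun c w => by
        ext a
        obtain ⟨x, hx⟩ := Bal.mk_surjective (δ a)
        simp only [LinearMap.comp_apply, LinearMap.smul_apply, ← hx, Bal.mapLeft_mk,
          RingHom.id_apply]
        rw [← map_smul, ← LinearMap.smul_apply, ← LinearMap.rTensor_smul]
        congr 3 })
    (by
      intro b w a
      obtain ⟨x, hx⟩ := Bal.mk_surjective (δ a)
      simp only [TensorProduct.lift.tmul, LinearMap.coe_mk, AddHom.coe_mk, LinearMap.comp_apply,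
        hδ b a x hx]
      simp only [← hx, Bal.mapLeft_mk]
      rw [← LinearMap.rTensor_comp_apply]
      congr 3
      ext a
      simp [ins, Bal.mk_balanced])

theorem indCo_ins {ρ : Qᵐᵒᵖ →ₐ[k] Module.End k A}
    {l : Q →ₐ[k] Module.End k N} (δ : A →ₗ[k] Bal ρ l)
    (h : ∀ x b a, ρ x (β b a) = β b (ρ x a)) (hδ : ∀ b, Colinear δ δ (β b)) (w : W) (a : A)
    (x : A ⊗[k] N) (hx : Bal.mk ρ l x = δ a) :
    indCo ω δ h hδ (ins ω β w a) = Bal.mk _ _ ((ins ω β w).rTensor N x) := by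
  simp only [indCo, ins, LinearMap.comp_apply, Bal.lift_mk, TensorProduct.mk_apply,
    TensorProduct.lift.tmul, LinearMap.coe_mk, AddHom.coe_mk, ← hx, Bal.mapLeft_mk]

/-- To check an identity for all representatives of `δ y`, it suffices to check it for one
representative for each generator `y = w ⊗ a`. -/
theorem rep_ind {Z : Type*} [AddCommGroup Z] [Module k Z] {ρ : Qᵐᵒᵖ →ₐ[k] Module.End k (Bal ω β)}
    {l : Q →ₐ[k] Module.End k N} (δ : Bal ω β →ₗ[k] Bal ρ l) (F : Bal ω β ⊗[k] N →ₗ[k] Z)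
    (hF : ∀ q m n, F (ρ (op q) m ⊗ₜ n) = F (m ⊗ₜ l q n)) (G : Bal ω β →ₗ[k] Z)
    (h : ∀ w a, ∃ x, Bal.mk ρ l x = δ (ins ω β w a) ∧ F x = G (ins ω β w a)) :
    ∀ y x, Bal.mk ρ l x = δ y → F x = G y := by
  have key : Bal.lift F hF ∘ₗ δ = G := Bal.hom_ext fun w a => by
    obtain ⟨x, hx, hG⟩ := h w a
    rw [LinearMap.comp_apply, ← hx, Bal.lift_mk, hG]
  intro y x hx
  rw [← key, LinearMap.comp_apply, ← hx, Bal.lift_mk]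

theorem indCo_intertwines {ρ : Qᵐᵒᵖ →ₐ[k] Module.End k A}
    {l : Q →ₐ[k] Module.End k N} (δ : A →ₗ[k] Bal ρ l)
    (h : ∀ x b a, ρ x (β b a) = β b (ρ x a)) (hδ : ∀ b, Colinear δ δ (β b))
    {X : Type*} [Ring X] [Algebra k X] (σ : X →ₐ[k] Module.End k A)
    (hσ : ∀ x b a, σ x (β b a) = β b (σ x a)) (x : X) (τ : Module.End k N)
    (hτ : ∀ q n, τ (l q n) = l q (τ n))
    (H : Intertwines δ (σ x) τ) :
    Intertwines (indCo ω δ h hδ) (indAct ω β σ hσ x) τ := by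
  intro y z hz
  symm
  refine rep_ind (indCo ω δ h hδ) (Bal.mk _ _ ∘ₗ τ.lTensor _) ?_
    (indCo ω δ h hδ ∘ₗ indAct ω β σ hσ x) ?_ y z hz
  · intro q m n
    simp [hτ, Bal.mk_balanced]
  · intro w a
    obtain ⟨t, ht⟩ := Bal.mk_surjective (δ a)
    refine ⟨_, (indCo_ins δ h hδ w a t ht).symm, ?_⟩
    rw [LinearMap.comp_apply, LinearMap.comp_apply, indAct_ins,
      indCo_ins δ h hδ w _ _ (H a t ht).symm]
    congr 1
    exact LinearMap.congr_fun (f := τ.lTensor _ ∘ₗ (ins ω β w).rTensor N)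
      (g := (ins ω β w).rTensor N ∘ₗ τ.lTensor A) (TensorProduct.ext' fun a n => rfl) t

theorem indCo_counital {ρ : Qᵐᵒᵖ →ₐ[k] Module.End k A}
    {l : Q →ₐ[k] Module.End k N} (δ : A →ₗ[k] Bal ρ l)
    (h : ∀ x b a, ρ x (β b a) = β b (ρ x a)) (hδ : ∀ b, Colinear δ δ (β b))
    (ε : N →ₗ[k] Q) (hε : ∀ q n, ε (l q n) = q * ε n) (H : RightCounital δ ε) :
    RightCounital (indCo ω δ h hδ) ε := by
  refine rep_ind (indCo ω δ h hδ) _ ?_ LinearMap.id ?_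
  · intro q m n
    simp [hε]
  · intro w a
    obtain ⟨t, ht⟩ := Bal.mk_surjective (δ a)
    refine ⟨_, (indCo_ins δ h hδ w a t ht).symm, ?_⟩
    rw [LinearMap.id_apply]
    conv_rhs => rw [← H a t ht]
    rw [← LinearMap.comp_apply, ← LinearMap.comp_apply]
    congr 1
    exact TensorProduct.ext' fun a n => rfl

theorem Tri.mapLeft_balanced {M X P M' : Type*} [AddCommGroup M] [Module k M] [AddCommGroup X]
    [Module k X] [AddCommGroup P] [Module k P] [AddCommGroup M'] [Module k M']
    {ρ₁ : Q₁ᵐᵒᵖ →ₐ[k] Module.End k M} {l₁ : Q₁ →ₐ[k] Module.End k X}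
    {ρ₂ : Q₂ᵐᵒᵖ →ₐ[k] Module.End k X} {l₂ : Q₂ →ₐ[k] Module.End k P}
    (δ : M' →ₗ[k] Bal ρ₁ l₁) (ρ' : Q₂ᵐᵒᵖ →ₐ[k] Module.End k M')
    (hδ : ∀ (q : Q₂) (m : M') (x : M ⊗[k] X), Bal.mk ρ₁ l₁ x = δ m →
      δ (ρ' (op q) m) = Bal.mk ρ₁ l₁ ((ρ₂ (op q)).lTensor M x)) (q : Q₂) (m : M') (p : P) :
    Tri.mapLeft ρ₂ l₂ δ (ρ' (op q) m ⊗ₜ p) = Tri.mapLeft ρ₂ l₂ δ (m ⊗ₜ l₂ q p) := by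
  obtain ⟨t, ht⟩ := Bal.mk_surjective (δ m)
  simp only [Tri.mapLeft, TensorProduct.lift.tmul, LinearMap.comp_apply, hδ q m t ht]
  simp only [← ht]
  have key : (Tri.joinLeft ρ₁ l₁ ρ₂ l₂).flip p ∘ₗ Bal.mk ρ₁ l₁ ∘ₗ (ρ₂ (op q)).lTensor M =
      (Tri.joinLeft ρ₁ l₁ ρ₂ l₂).flip (l₂ q p) ∘ₗ Bal.mk ρ₁ l₁ :=
    TensorProduct.ext' fun a b => by
      refine (Submodule.Quotient.eq _).2 ?_
      exact Submodule.subset_span (Or.inr ⟨q, a, b, p, by simp⟩)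
  exact LinearMap.congr_fun key t

theorem Tri.mapRight_balanced {M X P Y : Type*} [AddCommGroup M] [Module k M] [AddCommGroup X]
    [Module k X] [AddCommGroup P] [Module k P] [AddCommGroup Y] [Module k Y]
    {ρ₁ : Q₁ᵐᵒᵖ →ₐ[k] Module.End k M} {l₁ : Q₁ →ₐ[k] Module.End k X}
    {ρ₂ : Q₂ᵐᵒᵖ →ₐ[k] Module.End k X} {l₂ : Q₂ →ₐ[k] Module.End k P}
    (Δ : Y →ₗ[k] Bal ρ₂ l₂) (l' : Q₁ →ₐ[k] Module.End k Y)
    (hΔ : ∀ (q : Q₁) (y : Y) (x : X ⊗[k] P), Bal.mk ρ₂ l₂ x = Δ y →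
      Δ (l' q y) = Bal.mk ρ₂ l₂ ((l₁ q).rTensor P x)) (q : Q₁) (m : M) (y : Y) :
    Tri.mapRight ρ₁ l₁ Δ (ρ₁ (op q) m ⊗ₜ y) = Tri.mapRight ρ₁ l₁ Δ (m ⊗ₜ l' q y) := by
  obtain ⟨t, ht⟩ := Bal.mk_surjective (Δ y)
  simp only [Tri.mapRight, TensorProduct.lift.tmul, LinearMap.comp_apply, LinearMap.flip_apply,
    hΔ q y t ht]
  simp only [← ht]
  have key : (Tri.joinRight ρ₁ l₁ ρ₂ l₂).flip (ρ₁ (op q) m) ∘ₗ Bal.mk ρ₂ l₂ =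
      (Tri.joinRight ρ₁ l₁ ρ₂ l₂).flip m ∘ₗ Bal.mk ρ₂ l₂ ∘ₗ (l₁ q).rTensor P :=
    TensorProduct.ext' fun a b => by
      refine (Submodule.Quotient.eq _).2 ?_
      exact Submodule.subset_span (Or.inl ⟨q, m, a, b, by simp⟩)
  exact LinearMap.congr_fun key t

/-- `f ⊗ X ⊗ P` for a right `Q₁`-linear map `f`. -/
def Tri.mapFst {M M' X P : Type*} [AddCommGroup M] [Module k M] [AddCommGroup M'] [Module k M']
    [AddCommGroup X] [Module k X] [AddCommGroup P] [Module k P]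
    {ρ₁ : Q₁ᵐᵒᵖ →ₐ[k] Module.End k M} {ρ₁' : Q₁ᵐᵒᵖ →ₐ[k] Module.End k M'}
    {l₁ : Q₁ →ₐ[k] Module.End k X}
    {ρ₂ : Q₂ᵐᵒᵖ →ₐ[k] Module.End k X} {l₂ : Q₂ →ₐ[k] Module.End k P}
    (f : M →ₗ[k] M') (hf : ∀ q m, f (ρ₁ (op q) m) = ρ₁' (op q) (f m)) :
    Tri ρ₁ l₁ ρ₂ l₂ →ₗ[k] Tri ρ₁' l₁ ρ₂ l₂ :=
  Submodule.mapQ _ _ (f.rTensor (X ⊗[k] P)) (by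
    rw [triRel, Submodule.span_le]
    rintro _ (⟨q, m, x, p, rfl⟩ | ⟨q, m, x, p, rfl⟩)
    · exact Submodule.subset_span (Or.inl ⟨q, f m, x, p, by simp [hf]⟩)
    · exact Submodule.subset_span (Or.inr ⟨q, f m, x, p, by simp⟩))

theorem indCo_coassociative {ρ₁ : Q₁ᵐᵒᵖ →ₐ[k] Module.End k A} {l₁ : Q₁ →ₐ[k] Module.End k N}
    {ρ₂ : Q₂ᵐᵒᵖ →ₐ[k] Module.End k A} {l₂ : Q₂ →ₐ[k] Module.End k N}
    {ρN : Q₂ᵐᵒᵖ →ₐ[k] Module.End k N}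
    (δ₁ : A →ₗ[k] Bal ρ₁ l₁) (δ₂ : A →ₗ[k] Bal ρ₂ l₂) (Δ : N →ₗ[k] Bal ρN l₂)
    (h₁ : ∀ x b a, ρ₁ x (β b a) = β b (ρ₁ x a)) (h₂ : ∀ x b a, ρ₂ x (β b a) = β b (ρ₂ x a))
    (hδ₁ : ∀ b, Colinear δ₁ δ₁ (β b)) (hδ₂ : ∀ b, Colinear δ₂ δ₂ (β b))
    (hN : ∀ q q' n, ρN (op q) (l₁ q' n) = l₁ q' (ρN (op q) n))
    (hlin : ∀ q, Intertwines δ₁ (ρ₂ (op q)) (ρN (op q))) (hΔ : ∀ q, Colinear Δ Δ (l₁ q))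
    (H : Coassociative δ₁ δ₂ Δ) :
    Coassociative (indCo ω δ₁ h₁ hδ₁) (indCo ω δ₂ h₂ hδ₂) Δ := by
  have key : ∀ y x, Bal.mk _ l₂ x = indCo ω δ₂ h₂ hδ₂ y →
      Tri.mapLeft ρN l₂ (indCo ω δ₁ h₁ hδ₁) x =
      (Bal.lift (Tri.mapRight (indAct ω β ρ₁ h₁) l₁ Δ)
        (Tri.mapRight_balanced Δ l₁ hΔ) ∘ₗ indCo ω δ₁ h₁ hδ₁) y := by
    refine rep_ind _ _ ?_ _ ?_
    · exact Tri.mapLeft_balanced (indCo ω δ₁ h₁ hδ₁) (indAct ω β ρ₂ h₂) fun q =>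
        indCo_intertwines δ₁ h₁ hδ₁ ρ₂ h₂ (op q) (ρN (op q)) (hN q) (hlin q)
    · intro w a
      obtain ⟨t₁, ht₁⟩ := Bal.mk_surjective (δ₁ a)
      obtain ⟨t₂, ht₂⟩ := Bal.mk_surjective (δ₂ a)
      refine ⟨_, (indCo_ins δ₂ h₂ hδ₂ w a t₂ ht₂).symm, ?_⟩
      rw [LinearMap.comp_apply, indCo_ins δ₁ h₁ hδ₁ w a t₁ ht₁, Bal.lift_mk]
      let f := Tri.mapFst (ρ₁ := ρ₁) (ρ₁' := indAct ω β ρ₁ h₁) (l₁ := l₁) (ρ₂ := ρN) (l₂ := l₂)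
        (ins ω β w) (fun q m => (indAct_ins ρ₁ h₁ (op q) w m).symm)
      have e₁ : Tri.mapLeft ρN l₂ (indCo ω δ₁ h₁ hδ₁) ∘ₗ (ins ω β w).rTensor N =
          f ∘ₗ Tri.mapLeft ρN l₂ δ₁ := TensorProduct.ext' fun a p => by
        obtain ⟨t, ht⟩ := Bal.mk_surjective (δ₁ a)
        simp only [LinearMap.comp_apply, LinearMap.rTensor_tmul, Tri.mapLeft,
          TensorProduct.lift.tmul, indCo_ins δ₁ h₁ hδ₁ w a t ht, ← ht]
        exact LinearMap.congr_fun
          (f := (Tri.joinLeft (indAct ω β ρ₁ h₁) l₁ ρN l₂).flip p ∘ₗ Bal.mk _ _ ∘ₗ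
            (ins ω β w).rTensor N)
          (g := f ∘ₗ (Tri.joinLeft ρ₁ l₁ ρN l₂).flip p ∘ₗ Bal.mk _ _)
          (TensorProduct.ext' fun a n => rfl) t
      have e₂ : Tri.mapRight (indAct ω β ρ₁ h₁) l₁ Δ ∘ₗ (ins ω β w).rTensor N =
          f ∘ₗ Tri.mapRight ρ₁ l₁ Δ := TensorProduct.ext' fun a n => by
        obtain ⟨t, ht⟩ := Bal.mk_surjective (Δ n)
        simp only [LinearMap.comp_apply, LinearMap.rTensor_tmul, Tri.mapRight,
          TensorProduct.lift.tmul, LinearMap.flip_apply, ← ht]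
        exact LinearMap.congr_fun
          (f := (Tri.joinRight (indAct ω β ρ₁ h₁) l₁ ρN l₂).flip (ins ω β w a) ∘ₗ Bal.mk _ _)
          (g := f ∘ₗ (Tri.joinRight ρ₁ l₁ ρN l₂).flip a ∘ₗ Bal.mk _ _)
          (TensorProduct.ext' fun a n => rfl) t
      have e₁' := LinearMap.congr_fun e₁ t₂
      have e₂' := LinearMap.congr_fun e₂ t₁
      simp only [LinearMap.comp_apply] at e₁' e₂'
      rw [e₁', e₂', H a t₂ t₁ ht₂ ht₁]
  intro y x x' hx hx'
  rw [key y x hx, LinearMap.comp_apply, ← hx', Bal.lift_mk]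

end Induction

variable {k L R H A : Type*} [CommRing k] [Ring L] [Algebra k L] [Ring R] [Algebra k R]
  [Ring H] [Algebra k H] [Ring A] [Algebra k A]

/-- A right bialgebroid over `R` with total algebra `H`.  The `R`-bimodule structure of the coring
is `r h r' = h s(r') t(r)`. -/
structure RightBialgebroid (k R H : Type*) [CommRing k] [Ring R] [Algebra k R]
    [Ring H] [Algebra k H] where
  /-- source map -/
  s : R →ₐ[k] H
  /-- target map -/
  t : Rᵐᵒᵖ →ₐ[k] H
  comm : ∀ (r : R) (r' : Rᵐᵒᵖ), s r * t r' = t r' * s r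
  /-- coproduct -/
  Δ : H →ₗ[k] Bal (rmulActOp s) (rmulAct t)
  /-- counit -/
  ε : H →ₗ[k] R
  isCoring : IsCoring (rmulAct t) (rmulActOp s) Δ ε
  /-- `s(r) h⁽¹⁾ ⊗ h⁽²⁾ = h⁽¹⁾ ⊗ t(r) h⁽²⁾` -/
  takeuchi : ∀ (h : H) (r : R) (x : H ⊗[k] H), Bal.mk _ _ x = Δ h →
    Bal.mk (rmulActOp s) (rmulAct t) ((LinearMap.mulLeft k (s r)).rTensor H x) =
      Bal.mk (rmulActOp s) (rmulAct t) ((LinearMap.mulLeft k (t (op r))).lTensor H x)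
  comul_one : Δ 1 = Bal.mk _ _ (1 ⊗ₜ 1)
  /-- multiplicativity, for the factorwise multiplication of the Takeuchi product -/
  comul_mul : ∀ (h h' : H) (x x' : H ⊗[k] H), Bal.mk _ _ x = Δ h → Bal.mk _ _ x' = Δ h' →
    Δ (h * h') = Bal.mk _ _ (x * x')
  /-- `h ↦ ε(s(-) h)` is an anti-homomorphism into `End_k(R)`; its compatibility with the unit maps
  of the `R ⊗ R^op`-rings is contained in the bilinearity of `ε` -/
  counit_one : ∀ r : R, ε (s r * 1) = r
  counit_mul : ∀ (h h' : H) (r : R), ε (s r * (h * h')) = ε (s (ε (s r * h)) * h')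

/-- A left bialgebroid over `L` with total algebra `H`: the opposite notion.  The `L`-bimodule
structure of the coring is `l h l' = s(l) t(l') h`. -/
structure LeftBialgebroid (k L H : Type*) [CommRing k] [Ring L] [Algebra k L]
    [Ring H] [Algebra k H] where
  /-- source map -/
  s : L →ₐ[k] H
  /-- target map -/
  t : Lᵐᵒᵖ →ₐ[k] H
  comm : ∀ (r : L) (r' : Lᵐᵒᵖ), s r * t r' = t r' * s r
  /-- coproduct -/
  Δ : H →ₗ[k] Bal (lmulAct t) (lmulAct s)
  /-- counit -/
  ε : H →ₗ[k] L
  isCoring : IsCoring (lmulAct s) (lmulAct t) Δ ε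
  /-- `h₍₁₎ t(l) ⊗ h₍₂₎ = h₍₁₎ ⊗ h₍₂₎ s(l)` -/
  takeuchi : ∀ (h : H) (l : L) (x : H ⊗[k] H), Bal.mk _ _ x = Δ h →
    Bal.mk (lmulAct t) (lmulAct s) ((LinearMap.mulRight k (t (op l))).rTensor H x) =
      Bal.mk (lmulAct t) (lmulAct s) ((LinearMap.mulRight k (s l)).lTensor H x)
  comul_one : Δ 1 = Bal.mk _ _ (1 ⊗ₜ 1)
  comul_mul : ∀ (h h' : H) (x x' : H ⊗[k] H), Bal.mk _ _ x = Δ h → Bal.mk _ _ x' = Δ h' →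
    Δ (h * h') = Bal.mk _ _ (x * x')
  /-- `h ↦ ε(h t(-))` is a homomorphism into `End_k(L)` -/
  counit_one : ∀ l : L, ε (1 * t (op l)) = l
  counit_mul : ∀ (h h' : H) (l : L), ε (h * h' * t (op l)) = ε (h * t (op (ε (h' * t (op l)))))

/-- A Hopf algebroid over `k` with base algebras `L` and `R` and total algebra `H`. -/
structure HopfAlgebroid (k L R H : Type*) [CommRing k] [Ring L] [Algebra k L] [Ring R]
    [Algebra k R] [Ring H] [Algebra k H] where
  /-- the constituent left bialgebroid -/
  HL : LeftBialgebroid k L H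
  /-- the constituent right bialgebroid -/
  HR : RightBialgebroid k R H
  /-- the antipode -/
  S : H →ₗ[k] H
  sL_εL_tR : ∀ r : R, HL.s (HL.ε (HR.t (op r))) = HR.t (op r)
  tL_εL_sR : ∀ r : R, HL.t (op (HL.ε (HR.s r))) = HR.s r
  sR_εR_tL : ∀ l : L, HR.s (HR.ε (HL.t (op l))) = HL.t (op l)
  tR_εR_sL : ∀ l : L, HR.t (op (HR.ε (HL.s l))) = HL.s l
  /-- `(Δ_L ⊗_R H) Δ_R = (H ⊗_L Δ_R) Δ_L` -/
  coassoc_LR : Coassociative HL.Δ HR.Δ HR.Δ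
  /-- `(Δ_R ⊗_L H) Δ_L = (H ⊗_R Δ_L) Δ_R` -/
  coassoc_RL : Coassociative HR.Δ HL.Δ HL.Δ
  S_bimodule : ∀ (l : L) (r : R) (h : H),
    S (HL.t (op l) * h * HR.t (op r)) = HR.s r * S h * HL.s l
  /-- `μ (S ⊗_L H) Δ_L = s_R ε_R` -/
  antipode_left : ∀ (h : H) (x : H ⊗[k] H), Bal.mk _ _ x = HL.Δ h →
    LinearMap.mul' k H (S.rTensor H x) = HR.s (HR.ε h)
  /-- `μ (H ⊗_R S) Δ_R = s_L ε_L` -/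
  antipode_right : ∀ (h : H) (x : H ⊗[k] H), Bal.mk _ _ x = HR.Δ h →
    LinearMap.mul' k H (S.lTensor H x) = HL.s (HL.ε h)

/-! ### Comodules and comodule algebras -/

/-- A right comodule structure on `M` for the Hopf algebroid `𝓗`. -/
structure HComodule (𝓗 : HopfAlgebroid k L R H) (M : Type*) [AddCommGroup M] [Module k M] where
  /-- right `R`-module structure -/
  actR : Rᵐᵒᵖ →ₐ[k] Module.End k M
  /-- right `L`-module structure -/
  actL : Lᵐᵒᵖ →ₐ[k] Module.End k M
  /-- coaction `m ↦ m⁽⁰⁾ ⊗_R m⁽¹⁾` of the right bialgebroid -/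
  coR : M →ₗ[k] Bal actR (rmulAct 𝓗.HR.t)
  /-- coaction `m ↦ m₍₀₎ ⊗_L m₍₁₎` of the left bialgebroid -/
  coL : M →ₗ[k] Bal actL (lmulAct 𝓗.HL.s)
  isCoactionR : IsCoaction 𝓗.HR.Δ 𝓗.HR.ε coR
  isCoactionL : IsCoaction 𝓗.HL.Δ 𝓗.HL.ε coL
  /-- the `R`-coaction is right `L`-linear -/
  coR_linearL : ∀ l : L, Intertwines coR (actL (op l)) (lmulAct 𝓗.HL.t (op l))
  /-- the `L`-coaction is right `R`-linear -/
  coL_linearR : ∀ r : R, Intertwines coL (actR (op r)) (rmulActOp 𝓗.HR.s (op r))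
  /-- `(M ⊗_R Δ_L) ϱ_R = (ϱ_R ⊗_L H) ϱ_L` -/
  coassoc_RL : Coassociative coR coL 𝓗.HL.Δ
  /-- `(M ⊗_L Δ_R) ϱ_L = (ϱ_L ⊗_R H) ϱ_R` -/
  coassoc_LR : Coassociative coL coR 𝓗.HR.Δ

/-- Morphisms of comodules of a Hopf algebroid. -/
structure IsComoduleHom {𝓗 : HopfAlgebroid k L R H} {M N : Type*} [AddCommGroup M] [Module k M]
    [AddCommGroup N] [Module k N] (cM : HComodule 𝓗 M) (cN : HComodule 𝓗 N)
    (f : M →ₗ[k] N) : Prop where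
  map_actR : ∀ (r : R) (m : M), f (cM.actR (op r) m) = cN.actR (op r) (f m)
  map_actL : ∀ (l : L) (m : M), f (cM.actL (op l) m) = cN.actL (op l) (f m)
  /-- `f(m)⁽⁰⁾ ⊗_R f(m)⁽¹⁾ = f(m⁽⁰⁾) ⊗_R m⁽¹⁾` -/
  map_coR : ∀ (m : M) (x : M ⊗[k] H), Bal.mk _ _ x = cM.coR m →
    cN.coR (f m) = Bal.mk _ _ (f.rTensor H x)
  /-- `f(m)₍₀₎ ⊗_L f(m)₍₁₎ = f(m₍₀₎) ⊗_L m₍₁₎` -/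
  map_coL : ∀ (m : M) (x : M ⊗[k] H), Bal.mk _ _ x = cM.coL m →
    cN.coL (f m) = Bal.mk _ _ (f.rTensor H x)

theorem one_tmul_mul (c : H) (x : A ⊗[k] H) :
    (1 ⊗ₜ[k] c) * x = (LinearMap.mulLeft k c).lTensor A x :=
  LinearMap.congr_fun (f := LinearMap.mulLeft k (1 ⊗ₜ[k] c))
    (TensorProduct.ext' fun a b => by simp) x

theorem tmul_one_mul (b : A) (x : A ⊗[k] H) :
    (b ⊗ₜ[k] 1) * x = (LinearMap.mulLeft k b).rTensor H x :=
  LinearMap.congr_fun (f := LinearMap.mulLeft k (b ⊗ₜ[k] 1))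
    (TensorProduct.ext' fun a b => by simp) x

/-- `Δ_R` is right `L`-linear. -/
theorem HopfAlgebroid.comulR_linearL (𝓗 : HopfAlgebroid k L R H) (l : L) :
    Intertwines 𝓗.HR.Δ (lmulAct 𝓗.HL.t (op l)) (lmulAct 𝓗.HL.t (op l)) := by
  intro h x hx
  have h1 : 𝓗.HR.Δ (𝓗.HL.t (op l)) = Bal.mk _ _ (1 ⊗ₜ 𝓗.HL.t (op l)) := by
    simpa [𝓗.sR_εR_tL] using 𝓗.HR.isCoring.comul_right (𝓗.HR.ε (𝓗.HL.t (op l))) 1 (1 ⊗ₜ 1)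
      𝓗.HR.comul_one.symm
  rw [lmulAct_apply, 𝓗.HR.comul_mul _ _ _ x h1.symm hx, one_tmul_mul]
  rfl

/-- `Δ_L` is right `R`-linear. -/
theorem HopfAlgebroid.comulL_linearR (𝓗 : HopfAlgebroid k L R H) (r : R) :
    Intertwines 𝓗.HL.Δ (rmulActOp 𝓗.HR.s (op r)) (rmulActOp 𝓗.HR.s (op r)) := by
  intro h x hx
  have h1 : 𝓗.HL.Δ (𝓗.HR.s r) = Bal.mk _ _ (1 ⊗ₜ 𝓗.HR.s r) := by
    simpa [𝓗.tL_εL_sR] using 𝓗.HL.isCoring.comul_right (𝓗.HL.ε (𝓗.HR.s r)) 1 (1 ⊗ₜ 1)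
      𝓗.HL.comul_one.symm
  rw [rmulActOp_apply, 𝓗.HL.comul_mul _ _ x _ hx h1.symm]
  congr 1
  exact LinearMap.congr_fun (f := LinearMap.mulRight k (1 ⊗ₜ[k] 𝓗.HR.s r))
    (g := (rmulActOp 𝓗.HR.s (op r)).lTensor H) (TensorProduct.ext' fun a b => by simp) x

/-- `Δ_R` is left `L`-linear. -/
theorem HopfAlgebroid.comulR_leftL (𝓗 : HopfAlgebroid k L R H) (l : L) :
    Colinear 𝓗.HR.Δ 𝓗.HR.Δ (lmulAct 𝓗.HL.s l) := by
  intro h x hx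
  have h1 : 𝓗.HR.Δ (𝓗.HL.s l) = Bal.mk _ _ (𝓗.HL.s l ⊗ₜ 1) := by
    simpa [𝓗.tR_εR_sL] using 𝓗.HR.isCoring.comul_left (𝓗.HR.ε (𝓗.HL.s l)) 1 (1 ⊗ₜ 1)
      𝓗.HR.comul_one.symm
  rw [lmulAct_apply, 𝓗.HR.comul_mul _ _ _ x h1.symm hx, tmul_one_mul]
  rfl

/-- `Δ_L` is left `R`-linear. -/
theorem HopfAlgebroid.comulL_leftR (𝓗 : HopfAlgebroid k L R H) (r : R) :
    Colinear 𝓗.HL.Δ 𝓗.HL.Δ (rmulAct 𝓗.HR.t r) := by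
  intro h x hx
  have h1 : 𝓗.HL.Δ (𝓗.HR.t (op r)) = Bal.mk _ _ (𝓗.HR.t (op r) ⊗ₜ 1) := by
    simpa [𝓗.sL_εL_tR] using 𝓗.HL.isCoring.comul_left (𝓗.HL.ε (𝓗.HR.t (op r))) 1 (1 ⊗ₜ 1)
      𝓗.HL.comul_one.symm
  rw [rmulAct_apply, 𝓗.HL.comul_mul _ _ x _ hx h1.symm]
  congr 1
  exact LinearMap.congr_fun (f := LinearMap.mulRight k (𝓗.HR.t (op r) ⊗ₜ[k] 1))
    (g := (rmulAct 𝓗.HR.t r).rTensor H) (TensorProduct.ext' fun a b => by simp) x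

/-- The regular comodule: `H` with the two coproducts as coactions. -/
def HopfAlgebroid.regular (𝓗 : HopfAlgebroid k L R H) : HComodule 𝓗 H where
  actR := rmulActOp 𝓗.HR.s
  actL := lmulAct 𝓗.HL.t
  coR := 𝓗.HR.Δ
  coL := 𝓗.HL.Δ
  isCoactionR := ⟨𝓗.HR.isCoring.comul_right, 𝓗.HR.isCoring.coassoc,
    𝓗.HR.isCoring.counital_right⟩
  isCoactionL := ⟨𝓗.HL.isCoring.comul_right, 𝓗.HL.isCoring.coassoc,
    𝓗.HL.isCoring.counital_right⟩
  coR_linearL := 𝓗.comulR_linearL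
  coL_linearR := 𝓗.comulL_linearR
  coassoc_RL := 𝓗.coassoc_RL
  coassoc_LR := 𝓗.coassoc_LR

theorem HComodule.coR_injective {𝓗 : HopfAlgebroid k L R H} {M : Type*} [AddCommGroup M]
    [Module k M] (c : HComodule 𝓗 M) : Function.Injective c.coR := by
  intro m n h
  obtain ⟨x, hx⟩ := Bal.mk_surjective (c.coR m)
  rw [← c.isCoactionR.counital m x hx, ← c.isCoactionR.counital n x (hx.trans h)]

theorem HopfAlgebroid.S_one (𝓗 : HopfAlgebroid k L R H) : 𝓗.S 1 = 1 := by
  have h1 : 𝓗.HR.ε 1 = 1 := by simpa using 𝓗.HR.counit_one 1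
  have := 𝓗.antipode_left 1 _ 𝓗.HL.comul_one.symm
  simpa [h1] using this

/-- A coinvariant of the `H_R`-coaction is a coinvariant of the `H_L`-coaction. -/
theorem HComodule.coL_of_coR {𝓗 : HopfAlgebroid k L R H} {M : Type*} [AddCommGroup M]
    [Module k M] (c : HComodule 𝓗 M) {n : M} (hn : c.coR n = Bal.mk _ _ (n ⊗ₜ 1)) :
    c.coL n = Bal.mk _ _ (n ⊗ₜ 1) := by
  obtain ⟨y, hy⟩ := Bal.mk_surjective (c.coL n)
  have key := c.coassoc_LR n _ y hn.symm hy
  let V : Tri c.actL (lmulAct 𝓗.HL.s) (rmulActOp 𝓗.HR.s) (rmulAct 𝓗.HR.t) →ₗ[k]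
      Bal c.actL (lmulAct 𝓗.HL.s) :=
    (triRel _ _ _ _).liftQ
      (Bal.mk _ _ ∘ₗ (LinearMap.mul' k H ∘ₗ 𝓗.S.lTensor H).lTensor M) (by
        rw [triRel, Submodule.span_le]
        rintro _ (⟨q, m, x, p, rfl⟩ | ⟨q, m, x, p, rfl⟩)
        · have := Bal.mk_balanced (ρ := c.actL) (l := lmulAct 𝓗.HL.s) q m (x * 𝓗.S p)
          simp [this, mul_assoc]
        · have := 𝓗.S_bimodule 1 q p
          simp only [op_one, map_one, one_mul, mul_one] at this
          simp [this, mul_assoc])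
  have e₁ : V (Tri.mapLeft (rmulActOp 𝓗.HR.s) (rmulAct 𝓗.HR.t) c.coL (n ⊗ₜ 1)) = c.coL n := by
    simp only [Tri.mapLeft, TensorProduct.lift.tmul, LinearMap.comp_apply]
    rw [← hy]
    exact LinearMap.congr_fun
      (f := V ∘ₗ (Tri.joinLeft _ _ (rmulActOp 𝓗.HR.s) (rmulAct 𝓗.HR.t)).flip 1 ∘ₗ Bal.mk _ _)
      (g := Bal.mk _ _) (TensorProduct.ext' fun a h => by
        change Bal.mk _ _ (a ⊗ₜ (h * 𝓗.S 1)) = _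
        rw [𝓗.S_one, mul_one]) y
  have e₂ : V (Tri.mapRight c.actL (lmulAct 𝓗.HL.s) 𝓗.HR.Δ y) = Bal.mk _ _ (n ⊗ₜ 1) := by
    conv_rhs => rw [← c.isCoactionL.counital n y hy]
    refine LinearMap.congr_fun
      (f := V ∘ₗ Tri.mapRight c.actL (lmulAct 𝓗.HL.s) 𝓗.HR.Δ)
      (g := Bal.mk _ _ ∘ₗ (TensorProduct.mk k M H).flip 1 ∘ₗ TensorProduct.lift
        ((c.actL.toLinearMap ∘ₗ (opLinearEquiv k : L ≃ₗ[k] Lᵐᵒᵖ).toLinearMap ∘ₗ 𝓗.HL.ε).flip))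
      (TensorProduct.ext' fun m h => ?_) y
    obtain ⟨t, ht⟩ := Bal.mk_surjective (𝓗.HR.Δ h)
    simp only [LinearMap.comp_apply, Tri.mapRight, TensorProduct.lift.tmul, LinearMap.flip_apply,
      ← ht]
    have e₃ := LinearMap.congr_fun
      (f := V ∘ₗ (Tri.joinRight c.actL (lmulAct 𝓗.HL.s) (rmulActOp 𝓗.HR.s)
        (rmulAct 𝓗.HR.t)).flip m ∘ₗ Bal.mk _ _)
      (g := Bal.mk _ _ ∘ₗ TensorProduct.mk k M H m ∘ₗ LinearMap.mul' k H ∘ₗ 𝓗.S.lTensor H)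
      (TensorProduct.ext' fun a h => rfl) t
    simp only [LinearMap.comp_apply, LinearMap.flip_apply, 𝓗.antipode_right h t ht] at e₃
    rw [e₃]
    have := Bal.mk_balanced (ρ := c.actL) (l := lmulAct 𝓗.HL.s) (𝓗.HL.ε h) m 1
    simp only [lmulAct_apply, mul_one] at this
    exact this.symm
  rw [← e₁, key, e₂]

/-- A right comodule algebra structure on `A`: a monoid in the monoidal category of right
comodules.  The left `R`-action on the comodule `A` is left multiplication by `η_R`, and its left
`L`-action is `l a = a η_R(ε_R(t_L(l)))`; the two Takeuchi conditions make the factorwise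
products well defined. -/
structure ComoduleAlgebra (𝓗 : HopfAlgebroid k L R H) (A : Type*) [Ring A] [Algebra k A]
    extends HComodule 𝓗 A where
  /-- the unit map of the `R`-ring `A` -/
  ηR : R →ₐ[k] A
  actR_eq : ∀ (r : R) (a : A), actR (op r) a = a * ηR r
  coR_one : coR 1 = Bal.mk _ _ (1 ⊗ₜ 1)
  coL_one : coL 1 = Bal.mk _ _ (1 ⊗ₜ 1)
  /-- `η_R(r) a⁽⁰⁾ ⊗_R a⁽¹⁾ = a⁽⁰⁾ ⊗_R t_R(r) a⁽¹⁾` -/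
  coR_takeuchi : ∀ (a : A) (r : R) (x : A ⊗[k] H), Bal.mk _ _ x = coR a →
    Bal.mk actR (rmulAct 𝓗.HR.t) ((LinearMap.mulLeft k (ηR r)).rTensor H x) =
      Bal.mk actR (rmulAct 𝓗.HR.t) ((LinearMap.mulLeft k (𝓗.HR.t (op r))).lTensor A x)
  /-- `a₍₀₎ η_R(ε_R(t_L(l))) ⊗_L a₍₁₎ = a₍₀₎ ⊗_L a₍₁₎ s_L(l)` -/
  coL_takeuchi : ∀ (a : A) (l : L) (x : A ⊗[k] H), Bal.mk _ _ x = coL a →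
    Bal.mk actL (lmulAct 𝓗.HL.s)
        ((LinearMap.mulRight k (ηR (𝓗.HR.ε (𝓗.HL.t (op l))))).rTensor H x) =
      Bal.mk actL (lmulAct 𝓗.HL.s) ((LinearMap.mulRight k (𝓗.HL.s l)).lTensor A x)
  /-- `(aa')⁽⁰⁾ ⊗_R (aa')⁽¹⁾ = a⁽⁰⁾a'⁽⁰⁾ ⊗_R a⁽¹⁾a'⁽¹⁾` -/
  coR_mul : ∀ (a a' : A) (x x' : A ⊗[k] H), Bal.mk _ _ x = coR a → Bal.mk _ _ x' = coR a' →
    coR (a * a') = Bal.mk _ _ (x * x')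
  /-- `(aa')₍₀₎ ⊗_L (aa')₍₁₎ = a₍₀₎a'₍₀₎ ⊗_L a₍₁₎a'₍₁₎` -/
  coL_mul : ∀ (a a' : A) (x x' : A ⊗[k] H), Bal.mk _ _ x = coL a → Bal.mk _ _ x' = coL a' →
    coL (a * a') = Bal.mk _ _ (x * x')

namespace ComoduleAlgebra

variable {𝓗 : HopfAlgebroid k L R H}

/-- The subalgebra `B = A^{co H_R}` of coinvariants `b⁽⁰⁾ ⊗_R b⁽¹⁾ = b ⊗_R 1`. -/
def B (𝓐 : ComoduleAlgebra 𝓗 A) : Subalgebra k A where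
  carrier := {b | 𝓐.coR b = Bal.mk _ _ (b ⊗ₜ 1)}
  mul_mem' {a b} ha hb := by
    simpa using 𝓐.coR_mul a b _ _ (Eq.symm ha) (Eq.symm hb)
  add_mem' {a b} ha hb := by
    change _ = _ at ha hb
    change _ = _
    rw [map_add, ha, hb, TensorProduct.add_tmul, map_add]
  algebraMap_mem' c := by
    change _ = _
    rw [Algebra.algebraMap_eq_smul_one, map_smul, 𝓐.coR_one, ← TensorProduct.smul_tmul', map_smul]

theorem colinear_mulLeft (𝓐 : ComoduleAlgebra 𝓗 A) {b : A} (hb : b ∈ 𝓐.B) :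
    Colinear 𝓐.coR 𝓐.coR (LinearMap.mulLeft k b) := by
  intro a x hx
  rw [← tmul_one_mul]
  exact 𝓐.coR_mul b a _ x (Eq.symm hb) hx

/-- The coinvariants are also the elements `b` with `ϱ_R(b a) = b ϱ_R(a)` for all `a`. -/
theorem mem_B_iff (𝓐 : ComoduleAlgebra 𝓗 A) (b : A) :
    b ∈ 𝓐.B ↔ Colinear 𝓐.coR 𝓐.coR (LinearMap.mulLeft k b) := by
  refine ⟨𝓐.colinear_mulLeft, fun h => ?_⟩
  change 𝓐.coR b = _
  have := h 1 _ 𝓐.coR_one.symm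
  simpa using (this :)

/-- Left multiplication of the subalgebra of coinvariants on `A`. -/
def leftB (𝓐 : ComoduleAlgebra 𝓗 A) : 𝓐.B →ₐ[k] Module.End k A := lmulAct 𝓐.B.val

@[simp] theorem leftB_apply (𝓐 : ComoduleAlgebra 𝓗 A) (b : 𝓐.B) (a : A) :
    𝓐.leftB b a = b * a := rfl

theorem colinear_leftB_R (𝓐 : ComoduleAlgebra 𝓗 A) (b : 𝓐.B) :
    Colinear 𝓐.coR 𝓐.coR (𝓐.leftB b) := 𝓐.colinear_mulLeft b.2

theorem colinear_leftB_L (𝓐 : ComoduleAlgebra 𝓗 A) (b : 𝓐.B) :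
    Colinear 𝓐.coL 𝓐.coL (𝓐.leftB b) := by
  intro a x hx
  have := 𝓐.coL_mul b a _ x (𝓐.coL_of_coR b.2).symm hx
  rw [tmul_one_mul] at this
  exact this

theorem actR_leftB (𝓐 : ComoduleAlgebra 𝓗 A) (x : Rᵐᵒᵖ) (b : 𝓐.B) (a : A) :
    𝓐.actR x (𝓐.leftB b a) = 𝓐.leftB b (𝓐.actR x a) := by
  have h := 𝓐.actR_eq x.unop
  simp only [op_unop] at h
  simp [h, mul_assoc]

theorem actL_leftB (𝓐 : ComoduleAlgebra 𝓗 A) (x : Lᵐᵒᵖ) (b : 𝓐.B) (a : A) :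
    𝓐.actL x (𝓐.leftB b a) = 𝓐.leftB b (𝓐.actL x a) := by
  apply 𝓐.coR_injective
  obtain ⟨t, ht⟩ := Bal.mk_surjective (𝓐.coR a)
  have h1 := 𝓐.coR_linearL x.unop _ _ (𝓐.colinear_leftB_R b a t ht).symm
  have h2 := 𝓐.colinear_leftB_R b _ _ (𝓐.coR_linearL x.unop _ _ ht).symm
  rw [op_unop] at h1 h2
  rw [h1, h2]
  congr 1
  exact LinearMap.congr_fun
    (f := (lmulAct 𝓗.HL.t x).lTensor A ∘ₗ (𝓐.leftB b).rTensor H)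
    (g := (𝓐.leftB b).rTensor H ∘ₗ (lmulAct 𝓗.HL.t x).lTensor A)
    (TensorProduct.ext' fun a n => rfl) t

theorem actL_mul (𝓐 : ComoduleAlgebra 𝓗 A) (l : L) (a a' : A) :
    𝓐.actL (op l) a * a' = 𝓐.actL (op l) (a * a') := by
  apply 𝓐.coR_injective
  obtain ⟨t, ht⟩ := Bal.mk_surjective (𝓐.coR a)
  obtain ⟨t', ht'⟩ := Bal.mk_surjective (𝓐.coR a')
  rw [𝓐.coR_mul _ _ _ _ (𝓐.coR_linearL l a t ht).symm ht',
    𝓐.coR_linearL l _ _ (𝓐.coR_mul a a' t t' ht ht').symm]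
  have e : (lmulAct 𝓗.HL.t (op l)).lTensor A = LinearMap.mulLeft k (1 ⊗ₜ 𝓗.HL.t (op l)) :=
    TensorProduct.ext' fun a b => by simp
  rw [e, LinearMap.mulLeft_apply, LinearMap.mulLeft_apply, mul_assoc]

/-- The comodule `W ⊗_B A`, with the coactions of the second factor. -/
def indComod (𝓐 : ComoduleAlgebra 𝓗 A) {W : Type*} [AddCommGroup W] [Module k W]
    (ω : (𝓐.B)ᵐᵒᵖ →ₐ[k] Module.End k W) : HComodule 𝓗 (Bal ω 𝓐.leftB) where
  actR := indAct ω 𝓐.leftB 𝓐.actR 𝓐.actR_leftB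
  actL := indAct ω 𝓐.leftB 𝓐.actL 𝓐.actL_leftB
  coR := indCo ω 𝓐.coR 𝓐.actR_leftB 𝓐.colinear_leftB_R
  coL := indCo ω 𝓐.coL 𝓐.actL_leftB 𝓐.colinear_leftB_L
  isCoactionR :=
    { linear := fun r => indCo_intertwines _ _ _ _ _ _ _
        (fun q n => 𝓗.HR.isCoring.bimodule q r n) (𝓐.isCoactionR.linear r)
      coassoc := indCo_coassociative _ _ _ _ _ _ _ (fun r q n => 𝓗.HR.isCoring.bimodule q r n)
        𝓐.isCoactionR.linear 𝓗.HR.isCoring.comul_left 𝓐.isCoactionR.coassoc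
      counital := indCo_counital _ _ _ _ 𝓗.HR.isCoring.counit_left 𝓐.isCoactionR.counital }
  isCoactionL :=
    { linear := fun r => indCo_intertwines _ _ _ _ _ _ _
        (fun q n => 𝓗.HL.isCoring.bimodule q r n) (𝓐.isCoactionL.linear r)
      coassoc := indCo_coassociative _ _ _ _ _ _ _ (fun r q n => 𝓗.HL.isCoring.bimodule q r n)
        𝓐.isCoactionL.linear 𝓗.HL.isCoring.comul_left 𝓐.isCoactionL.coassoc
      counital := indCo_counital _ _ _ _ 𝓗.HL.isCoring.counit_left 𝓐.isCoactionL.counital }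
  coR_linearL := fun l => indCo_intertwines _ _ _ _ _ _ _
    (fun q n => by simp [mul_assoc]) (𝓐.coR_linearL l)
  coL_linearR := fun r => indCo_intertwines _ _ _ _ _ _ _
    (fun q n => by simp [mul_assoc]) (𝓐.coL_linearR r)
  coassoc_RL := indCo_coassociative _ _ _ _ _ _ _ (fun l r n => by simp [mul_assoc])
    𝓐.coR_linearL 𝓗.comulL_leftR 𝓐.coassoc_RL
  coassoc_LR := indCo_coassociative _ _ _ _ _ _ _ (fun r l n => by simp [mul_assoc])
    𝓐.coL_linearR 𝓗.comulR_leftL 𝓐.coassoc_LR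

/-- Cleaving data for the extension `B ⊆ A`: an `L`-ring structure on `A` with `B` an
`L`-subring, a cleaving map `j` and its convolution inverse `j̃`. -/
structure Cleaving (𝓐 : ComoduleAlgebra 𝓗 A) where
  /-- the unit map of the `L`-ring `A` -/
  ηL : L →ₐ[k] A
  ηL_mem : ∀ l : L, ηL l ∈ 𝓐.B
  /-- the cleaving map, a left `L`-linear morphism of right comodules -/
  j : H →ₗ[k] A
  j_left : ∀ (l : L) (h : H), j (𝓗.HL.s l * h) = ηL l * j h
  j_comod : IsComoduleHom 𝓗.regular 𝓐.toHComodule j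
  /-- the inverse `j̃` of the cleaving map, an `R`-`L`-bimodule map -/
  jt : H →ₗ[k] A
  jt_left : ∀ (r : R) (h : H), jt (h * 𝓗.HR.t (op r)) = 𝓐.ηR r * jt h
  jt_right : ∀ (l : L) (h : H), jt (𝓗.HL.t (op l) * h) = jt h * ηL l
  /-- `j(h⁽¹⁾) j̃(h⁽²⁾) = η_L(ε_L(h))` -/
  j_mul_jt : ∀ (h : H) (x : H ⊗[k] H), Bal.mk _ _ x = 𝓗.HR.Δ h →
    LinearMap.mul' k A (TensorProduct.map j jt x) = ηL (𝓗.HL.ε h)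
  /-- `j̃(h₍₁₎) j(h₍₂₎) = η_R(ε_R(h))` -/
  jt_mul_j : ∀ (h : H) (x : H ⊗[k] H), Bal.mk _ _ x = 𝓗.HL.Δ h →
    LinearMap.mul' k A (TensorProduct.map jt j x) = 𝓐.ηR (𝓗.HR.ε h)

/-- The extension `B ⊆ A` is `H`-cleft. -/
def IsCleft (𝓐 : ComoduleAlgebra 𝓗 A) : Prop := Nonempty 𝓐.Cleaving

end ComoduleAlgebra

/-! ### Relative Hopf modules -/

/-- For a right action `α` of `A` on `M`, the map
`(m ⊗ h, a ⊗ h') ↦ m a ⊗ h h'`. -/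
noncomputable def diagAct {M : Type*} [AddCommGroup M] [Module k M]
    (α : Aᵐᵒᵖ →ₐ[k] Module.End k M) :
    M ⊗[k] H →ₗ[k] A ⊗[k] H →ₗ[k] M ⊗[k] H :=
  TensorProduct.map₂
    ((α.toLinearMap ∘ₗ (opLinearEquiv k : A ≃ₗ[k] Aᵐᵒᵖ).toLinearMap).flip) (LinearMap.mul k H)

/-- A right-right relative Hopf module: a right module of the monoid `A` in the category of right
comodules. -/
structure RelHopfModule.{w, u₀, u₁, u₂, u₃, u₄} {k : Type u₀} {L : Type u₁} {R : Type u₂}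
    {H : Type u₃} {A : Type u₄} [CommRing k] [Ring L] [Algebra k L] [Ring R] [Algebra k R]
    [Ring H] [Algebra k H] [Ring A] [Algebra k A] {𝓗 : HopfAlgebroid k L R H}
    (𝓐 : ComoduleAlgebra 𝓗 A) where
  /-- the underlying type -/
  carrier : Type w
  [addCommGroup : AddCommGroup carrier]
  [module : Module k carrier]
  /-- the right comodule structure -/
  comod : HComodule 𝓗 carrier
  /-- the right `A`-module structure -/
  actA : Aᵐᵒᵖ →ₐ[k] Module.End k carrier
  /-- the `R`-actions of the `A`-module and of the comodule agree -/
  actA_ηR : ∀ (r : R) (m : carrier), actA (op (𝓐.ηR r)) m = comod.actR (op r) m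
  /-- `(ma)⁽⁰⁾ ⊗_R (ma)⁽¹⁾ = m⁽⁰⁾a⁽⁰⁾ ⊗_R m⁽¹⁾a⁽¹⁾` -/
  coR_act : ∀ (m : carrier) (a : A) (x : carrier ⊗[k] H) (y : A ⊗[k] H),
    Bal.mk _ _ x = comod.coR m → Bal.mk _ _ y = 𝓐.coR a →
    comod.coR (actA (op a) m) = Bal.mk _ _ (diagAct actA x y)
  /-- `(ma)₍₀₎ ⊗_L (ma)₍₁₎ = m₍₀₎a₍₀₎ ⊗_L m₍₁₎a₍₁₎` -/
  coL_act : ∀ (m : carrier) (a : A) (x : carrier ⊗[k] H) (y : A ⊗[k] H),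
    Bal.mk _ _ x = comod.coL m → Bal.mk _ _ y = 𝓐.coL a →
    comod.coL (actA (op a) m) = Bal.mk _ _ (diagAct actA x y)

attribute [instance] RelHopfModule.addCommGroup RelHopfModule.module

namespace RelHopfModule

variable {𝓗 : HopfAlgebroid k L R H} {𝓐 : ComoduleAlgebra 𝓗 A}

/-- Morphisms of relative Hopf modules: `A`-linear morphisms of comodules. -/
@[ext] structure Hom (M N : RelHopfModule 𝓐) where
  /-- the underlying linear map -/
  toLin : M.carrier →ₗ[k] N.carrier
  map_actA : ∀ (a : A) (m : M.carrier), toLin (M.actA (op a) m) = N.actA (op a) (toLin m)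
  comod : IsComoduleHom M.comod N.comod toLin

instance : Category (RelHopfModule 𝓐) where
  Hom M N := Hom M N
  id M := ⟨LinearMap.id, fun _ _ => rfl, ⟨fun _ _ => rfl, fun _ _ => rfl,
    fun m x hx => by simp [hx], fun m x hx => by simp [hx]⟩⟩
  comp f g := ⟨g.toLin ∘ₗ f.toLin, fun a m => by simp [f.map_actA, g.map_actA],
    ⟨fun r m => by simp [f.comod.map_actR, g.comod.map_actR],
     fun l m => by simp [f.comod.map_actL, g.comod.map_actL],
     fun m x hx => by
      rw [LinearMap.comp_apply, g.comod.map_coR _ _ (f.comod.map_coR m x hx).symm,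
        LinearMap.rTensor_comp_apply],
     fun m x hx => by
      rw [LinearMap.comp_apply, g.comod.map_coL _ _ (f.comod.map_coL m x hx).symm,
        LinearMap.rTensor_comp_apply]⟩⟩

/-- The `H_R`-coinvariants `{n | n⁽⁰⁾ ⊗_R n⁽¹⁾ = n ⊗_R 1}` of a relative Hopf module. -/
def coinv (M : RelHopfModule 𝓐) : AddSubgroup M.carrier where
  carrier := {n | M.comod.coR n = Bal.mk _ _ (n ⊗ₜ 1)}
  zero_mem' := by simp
  add_mem' {a b} ha hb := by
    change _ = _ at ha hb
    change _ = _
    rw [map_add, ha, hb, TensorProduct.add_tmul, map_add]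
  neg_mem' {a} ha := by
    change _ = _ at ha
    change _ = _
    rw [map_neg, ha, TensorProduct.neg_tmul, map_neg]

theorem actA_mem_coinv (M : RelHopfModule 𝓐) {n : M.carrier} (hn : n ∈ M.coinv) {b : A}
    (hb : b ∈ 𝓐.B) : M.actA (op b) n ∈ M.coinv := by
  have := M.coR_act n b _ _ (Eq.symm hn) (Eq.symm hb)
  change _ = _
  simpa [diagAct] using this

instance (M : RelHopfModule 𝓐) : SMul (𝓐.B)ᵐᵒᵖ M.coinv where
  smul b n := ⟨M.actA (op (b.unop : A)) n, M.actA_mem_coinv n.2 b.unop.2⟩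

theorem coe_smul_coinv (M : RelHopfModule 𝓐) (b : (𝓐.B)ᵐᵒᵖ) (n : M.coinv) :
    ((b • n : M.coinv) : M.carrier) = M.actA (op (b.unop : A)) n := rfl

/-- The right `B`-action on the coinvariants, induced by the `A`-action. -/
instance (M : RelHopfModule 𝓐) : Module (𝓐.B)ᵐᵒᵖ M.coinv where
  one_smul n := Subtype.ext (by simp [coe_smul_coinv])
  mul_smul b b' n := Subtype.ext (by simp [coe_smul_coinv])
  smul_zero b := Subtype.ext (by simp [coe_smul_coinv])
  smul_add b n n' := Subtype.ext (by simp [coe_smul_coinv])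
  add_smul b b' n := Subtype.ext (by simp [coe_smul_coinv])
  zero_smul n := Subtype.ext (by simp [coe_smul_coinv])

theorem Hom.map_coinv {M N : RelHopfModule 𝓐} (f : M ⟶ N) {n : M.carrier} (hn : n ∈ M.coinv) :
    f.toLin n ∈ N.coinv := by
  change _ = _
  simpa using f.comod.map_coR n _ (Eq.symm hn)

end RelHopfModule

/-- The coinvariants functor from relative Hopf modules to right `B`-modules. -/
def coinvariants {𝓗 : HopfAlgebroid k L R H} (𝓐 : ComoduleAlgebra 𝓗 A) :
    RelHopfModule.{v} 𝓐 ⥤ ModuleCat.{v} (𝓐.B)ᵐᵒᵖ where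
  obj M := ModuleCat.of _ M.coinv
  map f := ModuleCat.ofHom
    { toFun := fun n => ⟨f.toLin n, RelHopfModule.Hom.map_coinv f n.2⟩
      map_add' := fun n n' => Subtype.ext (map_add f.toLin n.1 n'.1)
      map_smul' := fun b n => Subtype.ext (f.map_actA b.unop n) }
  map_id _ := rfl
  map_comp _ _ := rfl


/-! ### The induction functor -/

section InductionFunctor

variable {𝓗 : HopfAlgebroid k L R H}

/-- The right `A`-action on `W ⊗_B A`. -/
def indActA (𝓐 : ComoduleAlgebra 𝓗 A) {W : Type*} [AddCommGroup W] [Module k W]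
    (ω : (𝓐.B)ᵐᵒᵖ →ₐ[k] Module.End k W) : Aᵐᵒᵖ →ₐ[k] Module.End k (Bal ω 𝓐.leftB) :=
  indAct ω 𝓐.leftB (Algebra.lsmul k k A) (fun x b a => mul_assoc (b : A) a x.unop)

@[simp] theorem indActA_ins (𝓐 : ComoduleAlgebra 𝓗 A) {W : Type*} [AddCommGroup W] [Module k W]
    (ω : (𝓐.B)ᵐᵒᵖ →ₐ[k] Module.End k W) (a : A) (w : W) (a' : A) :
    indActA 𝓐 ω (op a) (ins ω 𝓐.leftB w a') = ins ω 𝓐.leftB w (a' * a) := rfl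

theorem diagAct_rTensor_ins (𝓐 : ComoduleAlgebra 𝓗 A) {W : Type*} [AddCommGroup W] [Module k W]
    (ω : (𝓐.B)ᵐᵒᵖ →ₐ[k] Module.End k W) (w : W) (x y : A ⊗[k] H) :
    diagAct (indActA 𝓐 ω) ((ins ω 𝓐.leftB w).rTensor H x) y =
      (ins ω 𝓐.leftB w).rTensor H (x * y) := by
  have : (diagAct (indActA 𝓐 ω)).comp ((ins ω 𝓐.leftB w).rTensor H) =
      (LinearMap.mul k (A ⊗[k] H)).compr₂ ((ins ω 𝓐.leftB w).rTensor H) := by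
    refine TensorProduct.ext' fun a h => TensorProduct.ext' fun a' h' => ?_
    simp [diagAct]
  exact LinearMap.congr_fun (LinearMap.congr_fun this x) y

theorem diagAct_balanced_R (𝓐 : ComoduleAlgebra 𝓗 A) {W : Type*} [AddCommGroup W] [Module k W]
    (ω : (𝓐.B)ᵐᵒᵖ →ₐ[k] Module.End k W) (a : A) (y : A ⊗[k] H) (hy : Bal.mk _ _ y = 𝓐.coR a)
    (r : R) (m : Bal ω 𝓐.leftB) (h : H) :
    Bal.mk (𝓐.indComod ω).actR (rmulAct 𝓗.HR.t)
        (diagAct (indActA 𝓐 ω) ((𝓐.indComod ω).actR (op r) m ⊗ₜ h) y) =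
      Bal.mk (𝓐.indComod ω).actR (rmulAct 𝓗.HR.t)
        (diagAct (indActA 𝓐 ω) (m ⊗ₜ rmulAct 𝓗.HR.t r h) y) := by
  let F : H →ₗ[k] Bal ω 𝓐.leftB →ₗ[k] Bal (𝓐.indComod ω).actR (rmulAct 𝓗.HR.t) :=
    ((TensorProduct.mk k (Bal ω 𝓐.leftB) H).compr₂
      (Bal.mk _ _ ∘ₗ (diagAct (indActA 𝓐 ω)).flip y)).flip
  refine LinearMap.congr_fun (f := F h ∘ₗ (𝓐.indComod ω).actR (op r))
    (g := F (rmulAct 𝓗.HR.t r h)) (Bal.hom_ext fun w a₀ => ?_) m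
  let G : Bal 𝓐.actR (rmulAct 𝓗.HR.t) →ₗ[k] Bal (𝓐.indComod ω).actR (rmulAct 𝓗.HR.t) :=
    Bal.lift (Bal.mk _ _ ∘ₗ TensorProduct.map (ins ω 𝓐.leftB w ∘ₗ LinearMap.mulLeft k a₀)
      (LinearMap.mulLeft k h)) (fun q a' h' => by
        have := Bal.mk_balanced (ρ := (𝓐.indComod ω).actR) (l := rmulAct 𝓗.HR.t) q
          (ins ω 𝓐.leftB w (a₀ * a')) (h * h')
        simp only [LinearMap.comp_apply, TensorProduct.map_tmul, LinearMap.mulLeft_apply,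
          rmulAct_apply, 𝓐.actR_eq] at this ⊢
        rw [← mul_assoc, ← mul_assoc, ← this]
        congr 2
        change _ = ins ω 𝓐.leftB w (𝓐.actR (op q) (a₀ * a'))
        rw [𝓐.actR_eq])
  have e₁ : F h ((𝓐.indComod ω).actR (op r) (ins ω 𝓐.leftB w a₀)) =
      G (Bal.mk _ _ ((LinearMap.mulLeft k (𝓐.ηR r)).rTensor H y)) := by
    refine LinearMap.congr_fun (f := Bal.mk _ _ ∘ₗ diagAct (indActA 𝓐 ω)
      ((𝓐.indComod ω).actR (op r) (ins ω 𝓐.leftB w a₀) ⊗ₜ h))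
      (g := G ∘ₗ Bal.mk _ _ ∘ₗ (LinearMap.mulLeft k (𝓐.ηR r)).rTensor H)
      (TensorProduct.ext' fun a' h' => ?_) y
    change Bal.mk _ _ (ins ω 𝓐.leftB w (𝓐.actR (op r) a₀ * a') ⊗ₜ (h * h')) =
      Bal.mk _ _ (ins ω 𝓐.leftB w (a₀ * (𝓐.ηR r * a')) ⊗ₜ (h * h'))
    rw [𝓐.actR_eq, mul_assoc]
  have e₂ : F (rmulAct 𝓗.HR.t r h) (ins ω 𝓐.leftB w a₀) =
      G (Bal.mk _ _ ((LinearMap.mulLeft k (𝓗.HR.t (op r))).lTensor A y)) := by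
    refine LinearMap.congr_fun (f := Bal.mk _ _ ∘ₗ diagAct (indActA 𝓐 ω)
      (ins ω 𝓐.leftB w a₀ ⊗ₜ rmulAct 𝓗.HR.t r h))
      (g := G ∘ₗ Bal.mk _ _ ∘ₗ (LinearMap.mulLeft k (𝓗.HR.t (op r))).lTensor A)
      (TensorProduct.ext' fun a' h' => ?_) y
    change Bal.mk _ _ (ins ω 𝓐.leftB w (a₀ * a') ⊗ₜ (h * 𝓗.HR.t (op r) * h')) =
      Bal.mk _ _ (ins ω 𝓐.leftB w (a₀ * a') ⊗ₜ (h * (𝓗.HR.t (op r) * h')))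
    rw [mul_assoc]
  rw [LinearMap.comp_apply, e₁, e₂, 𝓐.coR_takeuchi a r y hy]

theorem diagAct_balanced_L (𝓐 : ComoduleAlgebra 𝓗 A) {W : Type*} [AddCommGroup W] [Module k W]
    (ω : (𝓐.B)ᵐᵒᵖ →ₐ[k] Module.End k W) (y : A ⊗[k] H)
    (l : L) (m : Bal ω 𝓐.leftB) (h : H) :
    Bal.mk (𝓐.indComod ω).actL (lmulAct 𝓗.HL.s)
        (diagAct (indActA 𝓐 ω) ((𝓐.indComod ω).actL (op l) m ⊗ₜ h) y) =
      Bal.mk (𝓐.indComod ω).actL (lmulAct 𝓗.HL.s)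
        (diagAct (indActA 𝓐 ω) (m ⊗ₜ lmulAct 𝓗.HL.s l h) y) := by
  let F : H →ₗ[k] Bal ω 𝓐.leftB →ₗ[k] Bal (𝓐.indComod ω).actL (lmulAct 𝓗.HL.s) :=
    ((TensorProduct.mk k (Bal ω 𝓐.leftB) H).compr₂
      (Bal.mk _ _ ∘ₗ (diagAct (indActA 𝓐 ω)).flip y)).flip
  refine LinearMap.congr_fun (f := F h ∘ₗ (𝓐.indComod ω).actL (op l))
    (g := F (lmulAct 𝓗.HL.s l h)) (Bal.hom_ext fun w a₀ => ?_) m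
  refine LinearMap.congr_fun (f := Bal.mk _ _ ∘ₗ diagAct (indActA 𝓐 ω)
      ((𝓐.indComod ω).actL (op l) (ins ω 𝓐.leftB w a₀) ⊗ₜ h))
    (g := Bal.mk _ _ ∘ₗ diagAct (indActA 𝓐 ω)
      (ins ω 𝓐.leftB w a₀ ⊗ₜ lmulAct 𝓗.HL.s l h)) (TensorProduct.ext' fun a' h' => ?_) y
  change Bal.mk _ _ (ins ω 𝓐.leftB w (𝓐.actL (op l) a₀ * a') ⊗ₜ (h * h')) =
    Bal.mk _ _ (ins ω 𝓐.leftB w (a₀ * a') ⊗ₜ (𝓗.HL.s l * h * h'))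
  rw [𝓐.actL_mul, mul_assoc]
  exact Bal.mk_balanced (ρ := (𝓐.indComod ω).actL) (l := lmulAct 𝓗.HL.s) l
    (ins ω 𝓐.leftB w (a₀ * a')) (h * h')

/-- The relative Hopf module `W ⊗_B A` for a right `B`-module `W`, with the `A`-action and the
coactions of the second factor. -/
def indRelHopfModule (𝓐 : ComoduleAlgebra 𝓗 A) {W : Type*} [AddCommGroup W] [Module k W]
    (ω : (𝓐.B)ᵐᵒᵖ →ₐ[k] Module.End k W) : RelHopfModule 𝓐 where
  carrier := Bal ω 𝓐.leftB
  comod := 𝓐.indComod ω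
  actA := indActA 𝓐 ω
  actA_ηR r m := by
    refine LinearMap.congr_fun (Bal.hom_ext fun w a => ?_) m
    change ins ω _ w (a * 𝓐.ηR r) = ins ω _ w (𝓐.actR (op r) a)
    rw [𝓐.actR_eq]
  coR_act m a x y hx hy := by
    symm
    refine rep_ind (𝓐.indComod ω).coR
      (Bal.mk _ _ ∘ₗ (diagAct (indActA 𝓐 ω)).flip y) (diagAct_balanced_R 𝓐 ω a y hy)
      ((𝓐.indComod ω).coR ∘ₗ indActA 𝓐 ω (op a)) ?_ m x hx
    intro w a'
    obtain ⟨t, ht⟩ := Bal.mk_surjective (𝓐.coR a')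
    refine ⟨_, (indCo_ins _ 𝓐.actR_leftB 𝓐.colinear_leftB_R w a' t ht).symm, ?_⟩
    simp only [LinearMap.comp_apply, LinearMap.flip_apply]
    rw [diagAct_rTensor_ins 𝓐 ω, indActA_ins]
    exact (indCo_ins _ 𝓐.actR_leftB 𝓐.colinear_leftB_R w _ _ (𝓐.coR_mul a' a t y ht hy).symm).symm
  coL_act m a x y hx hy := by
    symm
    refine rep_ind (𝓐.indComod ω).coL
      (Bal.mk _ _ ∘ₗ (diagAct (indActA 𝓐 ω)).flip y) (diagAct_balanced_L 𝓐 ω y)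
      ((𝓐.indComod ω).coL ∘ₗ indActA 𝓐 ω (op a)) ?_ m x hx
    intro w a'
    obtain ⟨t, ht⟩ := Bal.mk_surjective (𝓐.coL a')
    refine ⟨_, (indCo_ins _ 𝓐.actL_leftB 𝓐.colinear_leftB_L w a' t ht).symm, ?_⟩
    simp only [LinearMap.comp_apply, LinearMap.flip_apply]
    rw [diagAct_rTensor_ins 𝓐 ω, indActA_ins]
    exact (indCo_ins _ 𝓐.actL_leftB 𝓐.colinear_leftB_L w _ _ (𝓐.coL_mul a' a t y ht hy).symm).symm

/-- The `k`-module underlying a right `B`-module. -/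
instance moduleBase (𝓐 : ComoduleAlgebra 𝓗 A) (W : ModuleCat.{v} (𝓐.B)ᵐᵒᵖ) : Module k W :=
  Module.compHom W (algebraMap k (𝓐.B)ᵐᵒᵖ)

theorem isScalarTower_base (𝓐 : ComoduleAlgebra 𝓗 A) (W : ModuleCat.{v} (𝓐.B)ᵐᵒᵖ) :
    IsScalarTower k (𝓐.B)ᵐᵒᵖ W :=
  ⟨fun c b w => by
    rw [Algebra.smul_def, mul_smul]; rfl⟩

/-- The action homomorphism of a right `B`-module. -/
def actB (𝓐 : ComoduleAlgebra 𝓗 A) (W : ModuleCat.{v} (𝓐.B)ᵐᵒᵖ) :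
    (𝓐.B)ᵐᵒᵖ →ₐ[k] Module.End k W :=
  haveI := isScalarTower_base 𝓐 W
  Algebra.lsmul k k W

@[simp] theorem actB_apply (𝓐 : ComoduleAlgebra 𝓗 A) (W : ModuleCat.{v} (𝓐.B)ᵐᵒᵖ)
    (b : (𝓐.B)ᵐᵒᵖ) (w : W) : actB 𝓐 W b w = b • w := rfl

/-- The `k`-linear map underlying a morphism of right `B`-modules. -/
def homBase (𝓐 : ComoduleAlgebra 𝓗 A) {W W' : ModuleCat.{v} (𝓐.B)ᵐᵒᵖ} (f : W ⟶ W') :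
    W →ₗ[k] W' where
  toFun := f
  map_add' := map_add f.hom
  map_smul' c w := map_smul f.hom (algebraMap k (𝓐.B)ᵐᵒᵖ c) w

/-- `f ⊗_B A : W ⊗_B A → W' ⊗_B A` for a morphism `f` of right `B`-modules. -/
def indMap (𝓐 : ComoduleAlgebra 𝓗 A) {W W' : ModuleCat.{v} (𝓐.B)ᵐᵒᵖ} (f : W ⟶ W') :
    Bal (actB 𝓐 W) 𝓐.leftB →ₗ[k] Bal (actB 𝓐 W') 𝓐.leftB :=
  Bal.mapLeft 𝓐.leftB (homBase 𝓐 f) (fun b w => map_smul f.hom (op b) w)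

theorem indMap_ins (𝓐 : ComoduleAlgebra 𝓗 A) {W W' : ModuleCat.{v} (𝓐.B)ᵐᵒᵖ} (f : W ⟶ W')
    (w : W) (a : A) : indMap 𝓐 f (ins (actB 𝓐 W) 𝓐.leftB w a) =
      ins (actB 𝓐 W') 𝓐.leftB (f w) a := rfl

theorem indMap_comp_ins (𝓐 : ComoduleAlgebra 𝓗 A) {W W' : ModuleCat.{v} (𝓐.B)ᵐᵒᵖ} (f : W ⟶ W')
    (w : W) : indMap 𝓐 f ∘ₗ ins (actB 𝓐 W) 𝓐.leftB w = ins (actB 𝓐 W') 𝓐.leftB (f w) := rfl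

theorem indMap_isComoduleHom (𝓐 : ComoduleAlgebra 𝓗 A) {W W' : ModuleCat.{v} (𝓐.B)ᵐᵒᵖ}
    (f : W ⟶ W') :
    IsComoduleHom (𝓐.indComod (actB 𝓐 W)) (𝓐.indComod (actB 𝓐 W')) (indMap 𝓐 f) := by
  have hR : ∀ (r : R) m, indMap 𝓐 f ((𝓐.indComod (actB 𝓐 W)).actR (op r) m) =
      (𝓐.indComod (actB 𝓐 W')).actR (op r) (indMap 𝓐 f m) := fun r m =>
    LinearMap.congr_fun (f := indMap 𝓐 f ∘ₗ (𝓐.indComod (actB 𝓐 W)).actR (op r))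
      (g := (𝓐.indComod (actB 𝓐 W')).actR (op r) ∘ₗ indMap 𝓐 f)
      (Bal.hom_ext fun w a => rfl) m
  have hL : ∀ (l : L) m, indMap 𝓐 f ((𝓐.indComod (actB 𝓐 W)).actL (op l) m) =
      (𝓐.indComod (actB 𝓐 W')).actL (op l) (indMap 𝓐 f m) := fun l m =>
    LinearMap.congr_fun (f := indMap 𝓐 f ∘ₗ (𝓐.indComod (actB 𝓐 W)).actL (op l))
      (g := (𝓐.indComod (actB 𝓐 W')).actL (op l) ∘ₗ indMap 𝓐 f)
      (Bal.hom_ext fun w a => rfl) m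
  refine ⟨hR, hL, fun m x hx => ?_, fun m x hx => ?_⟩
  · symm
    refine rep_ind (𝓐.indComod (actB 𝓐 W)).coR (Bal.mk _ _ ∘ₗ (indMap 𝓐 f).rTensor H)
      (fun r m h => ?_) ((𝓐.indComod (actB 𝓐 W')).coR ∘ₗ indMap 𝓐 f) (fun w a => ?_) m x hx
    · simp only [LinearMap.comp_apply, LinearMap.rTensor_tmul, hR, Bal.mk_balanced]
    · obtain ⟨t, ht⟩ := Bal.mk_surjective (𝓐.coR a)
      refine ⟨_, (indCo_ins _ 𝓐.actR_leftB 𝓐.colinear_leftB_R w a t ht).symm, ?_⟩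
      rw [LinearMap.comp_apply, LinearMap.comp_apply, ← LinearMap.rTensor_comp_apply,
        indMap_comp_ins, indMap_ins]
      exact (indCo_ins _ 𝓐.actR_leftB 𝓐.colinear_leftB_R (f w) a t ht).symm
  · symm
    refine rep_ind (𝓐.indComod (actB 𝓐 W)).coL (Bal.mk _ _ ∘ₗ (indMap 𝓐 f).rTensor H)
      (fun r m h => ?_) ((𝓐.indComod (actB 𝓐 W')).coL ∘ₗ indMap 𝓐 f) (fun w a => ?_) m x hx
    · simp only [LinearMap.comp_apply, LinearMap.rTensor_tmul, hL, Bal.mk_balanced]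
    · obtain ⟨t, ht⟩ := Bal.mk_surjective (𝓐.coL a)
      refine ⟨_, (indCo_ins _ 𝓐.actL_leftB 𝓐.colinear_leftB_L w a t ht).symm, ?_⟩
      rw [LinearMap.comp_apply, LinearMap.comp_apply, ← LinearMap.rTensor_comp_apply,
        indMap_comp_ins, indMap_ins]
      exact (indCo_ins _ 𝓐.actL_leftB 𝓐.colinear_leftB_L (f w) a t ht).symm

end InductionFunctor

/-- The induction functor `- ⊗_B A` from right `B`-modules to relative Hopf modules. -/
def induction.{w, u₀, u₁, u₂, u₃, u₄} {k : Type u₀} {L : Type u₁} {R : Type u₂}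
    {H : Type u₃} {A : Type u₄} [CommRing k] [Ring L] [Algebra k L] [Ring R] [Algebra k R]
    [Ring H] [Algebra k H] [Ring A] [Algebra k A] {𝓗 : HopfAlgebroid k L R H}
    (𝓐 : ComoduleAlgebra 𝓗 A) :
    ModuleCat.{max w u₄} (𝓐.B)ᵐᵒᵖ ⥤ RelHopfModule.{max w u₄} 𝓐 where
  obj W := indRelHopfModule 𝓐 (actB 𝓐 W)
  map {W W'} f :=
    { toLin := indMap 𝓐 f
      map_actA := fun a m => LinearMap.congr_fun
        (f := indMap 𝓐 f ∘ₗ indActA 𝓐 (actB 𝓐 W) (op a))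
        (g := indActA 𝓐 (actB 𝓐 W') (op a) ∘ₗ indMap 𝓐 f)
        (Bal.hom_ext fun w a => rfl) m
      comod := indMap_isComoduleHom 𝓐 f }
  map_id W := RelHopfModule.Hom.ext (Bal.hom_ext fun w a => rfl)
  map_comp f g := RelHopfModule.Hom.ext (Bal.hom_ext fun w a => rfl)

section Formulas

variable {𝓗 : HopfAlgebroid k L R H} {𝓐 : ComoduleAlgebra 𝓗 A}

/-- The element of `M` underlying an element of the coinvariants of `M`. -/
def coinvVal (M : RelHopfModule.{v} 𝓐) (n : (coinvariants 𝓐).obj M) : M.carrier :=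
  Subtype.val (p := fun n => n ∈ M.coinv) n

/-- The map `M ⊗_k H → M`, `m ⊗ h ↦ m j̃(h)`. -/
noncomputable def ComoduleAlgebra.Cleaving.actJt (c : 𝓐.Cleaving) (M : RelHopfModule.{v} 𝓐) :
    M.carrier ⊗[k] H →ₗ[k] M.carrier :=
  TensorProduct.lift
    ((M.actA.toLinearMap ∘ₗ (opLinearEquiv k : A ≃ₗ[k] Aᵐᵒᵖ).toLinearMap ∘ₗ c.jt).flip)

/-- The map `W ⊗_k A → W`, `w ⊗ a ↦ w θ(a)`, for a `k`-linear map `θ : A → B` and a right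
`B`-module `W`. -/
noncomputable def actVia (θ : A →ₗ[k] 𝓐.B) (W : ModuleCat.{v} (𝓐.B)ᵐᵒᵖ) : W ⊗[k] A →ₗ[k] W :=
  TensorProduct.lift
    (((actB 𝓐 W).toLinearMap ∘ₗ (opLinearEquiv k : 𝓐.B ≃ₗ[k] (𝓐.B)ᵐᵒᵖ).toLinearMap ∘ₗ θ).flip)

end Formulas

end HopfAlgd

/-!
The induction functor is left adjoint to the coinvariants functor for every comodule algebra
(`inductionAdjunction`); a cleaving map `j` with inverse `j̃` makes the unit and the counit
bijective.

The heart of the proof is the map `π(m) = m⁽⁰⁾ j̃(m⁽¹⁾)` on a relative Hopf module `M`.  The relation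
`j̃(h₍₁₎) j(h₍₂₎) = η_R(ε_R(h))` and mixed coassociativity give `π(m₍₀₎) j(m₍₁₎) = m`
(`Cleaving.proj_mul_j`).  That `π(m)` is coinvariant (`Cleaving.proj_mem_coinv`) needs
no formula for the coaction on `j̃`; it follows from the cancellation principle
`Coassociative.convolution_cancel`: a map `X` from `M` to a right `A`-module with
`X(m l) = X(m) η_L(l)` is recovered from `Y(m) = X(m₍₀₎) j(m₍₁₎)` as `X(m) = Y(m⁽⁰⁾) j̃(m⁽¹⁾)`.  The
principle is applied to `X(m) = ϱ_R(π(m)) - π(m) ⊗ 1` with values in `M ⊗_R H`, an `A`-module under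
the diagonal action `RelHopfModule.tensorAct`; there `Y = 0`, since both terms contribute `ϱ_R(m)`.
The equation `ϱ_R(π(m)) = π(m) ⊗ 1` is thus obtained in `M ⊗_R H` itself, and no tensor product of
an inclusion of coinvariants has to be injective; this is why no purity assumption is needed.

The map `m ↦ π(m₍₀₎) ⊗_B j(m₍₁₎)` is then inverse to the counit: one composite is the identity by the
formula above, the other because `π(n a) = n π(a)` for coinvariant `n`.  For the second composite
the left coaction of `n a` is needed, and the antipode enters here: an `H_R`-coinvariant is also an
`H_L`-coinvariant (`HComodule.coL_of_coR`).

For the unit, `θ(a) = π(a) j(1)` is a left `B`-linear retraction of `A` onto `B`, so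
`w ⊗ a ↦ w θ(a)` is a left inverse of the unit.  It is a right inverse because a coinvariant `y` of
`W ⊗_B A` satisfies `y = y j̃(1) j(1) = π(y) j(1)`, and `π(w ⊗ a) j(1) = w θ(a) ⊗ 1`.
-/

namespace HopfAlgd

/-! ### Convolution along a coassociative pair of coactions -/

section Convolution

variable {k Q₁ Q₂ A M N Z Z' : Type*} [CommRing k] [Ring Q₁] [Algebra k Q₁] [Ring Q₂]
  [Algebra k Q₂] [Ring A] [Algebra k A] [AddCommGroup M] [Module k M] [AddCommGroup N] [Module k N]
  [AddCommGroup Z] [Module k Z] [AddCommGroup Z'] [Module k Z']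

/-- The map `Z ⊗_k N → Z`, `z ⊗ n ↦ z f(n)`, for a right `A`-module `Z` and a linear map
`f : N → A`. -/
noncomputable def actThrough (α : Aᵐᵒᵖ →ₐ[k] Module.End k Z) (f : N →ₗ[k] A) :
    Z ⊗[k] N →ₗ[k] Z :=
  TensorProduct.lift
    ((α.toLinearMap ∘ₗ (opLinearEquiv k : A ≃ₗ[k] Aᵐᵒᵖ).toLinearMap ∘ₗ f).flip)

@[simp] theorem actThrough_tmul (α : Aᵐᵒᵖ →ₐ[k] Module.End k Z) (f : N →ₗ[k] A) (z : Z) (n : N) :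
    actThrough α f (z ⊗ₜ n) = α (op (f n)) z := rfl

variable {ρ₁ : Q₁ᵐᵒᵖ →ₐ[k] Module.End k M} {l₁ : Q₁ →ₐ[k] Module.End k N}
  {ρ₂ : Q₂ᵐᵒᵖ →ₐ[k] Module.End k M} {l₂ : Q₂ →ₐ[k] Module.End k N}
  {ρN : Q₂ᵐᵒᵖ →ₐ[k] Module.End k N}
  {δ₁ : M →ₗ[k] Bal ρ₁ l₁} {δ₂ : M →ₗ[k] Bal ρ₂ l₂} {Δ : N →ₗ[k] Bal ρN l₂}

/-- The image of the coassociativity law under the map `m ⊗ n ⊗ n' ↦ G(F(m ⊗ n) ⊗ n')` on the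
triple tensor product: if `Y(m)` is `F` evaluated on `δ₁ m`, and `P(m ⊗ n)` is
`G(F(m ⊗ -) ⊗ -)` evaluated on `Δ n`, then `G(Y ⊗ N)` on `δ₂ m` agrees with `P` on `δ₁ m`. -/
theorem Coassociative.apply (h : Coassociative δ₁ δ₂ Δ)
    (F : M ⊗[k] N →ₗ[k] Z) (hF : ∀ q m n, F (ρ₁ (op q) m ⊗ₜ n) = F (m ⊗ₜ l₁ q n))
    (G : Z ⊗[k] N →ₗ[k] Z')
    (hG : ∀ q m n n', G (F (m ⊗ₜ ρN (op q) n) ⊗ₜ n') = G (F (m ⊗ₜ n) ⊗ₜ l₂ q n'))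
    (Y : M →ₗ[k] Z) (hY : ∀ m y, Bal.mk ρ₁ l₁ y = δ₁ m → Y m = F y)
    (P : M ⊗[k] N →ₗ[k] Z')
    (hP : ∀ m n t, Bal.mk ρN l₂ t = Δ n →
      P (m ⊗ₜ n) = G ((F ∘ₗ TensorProduct.mk k M N m).rTensor N t))
    (m : M) (x y : M ⊗[k] N) (hx : Bal.mk ρ₂ l₂ x = δ₂ m) (hy : Bal.mk ρ₁ l₁ y = δ₁ m) :
    G (Y.rTensor N x) = P y := by
  -- the map `m ⊗ n ⊗ n' ↦ G(F(m ⊗ n) ⊗ n')` on the triple tensor product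
  let V : Tri ρ₁ l₁ ρN l₂ →ₗ[k] Z' :=
    (triRel ρ₁ l₁ ρN l₂).liftQ
      (G ∘ₗ F.rTensor N ∘ₗ (TensorProduct.assoc k M N N).symm.toLinearMap) (by
        rw [triRel, Submodule.span_le]
        rintro _ (⟨q, m, x, p, rfl⟩ | ⟨q, m, x, p, rfl⟩)
        · simp [hF]
        · simp [hG])
  have e₁ : V ∘ₗ Tri.mapLeft ρN l₂ δ₁ = G ∘ₗ Y.rTensor N := TensorProduct.ext' fun m p => by
    obtain ⟨t, ht⟩ := Bal.mk_surjective (δ₁ m)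
    simp only [LinearMap.comp_apply, Tri.mapLeft, TensorProduct.lift.tmul, LinearMap.rTensor_tmul,
      hY m t ht, ← ht]
    exact LinearMap.congr_fun
      (f := V ∘ₗ (Tri.joinLeft ρ₁ l₁ ρN l₂).flip p ∘ₗ Bal.mk _ _)
      (g := G ∘ₗ (TensorProduct.mk k Z N).flip p ∘ₗ F) (TensorProduct.ext' fun a n => rfl) t
  have e₂ : V ∘ₗ Tri.mapRight ρ₁ l₁ Δ = P := TensorProduct.ext' fun m n => by
    obtain ⟨t, ht⟩ := Bal.mk_surjective (Δ n)
    simp only [LinearMap.comp_apply, Tri.mapRight, TensorProduct.lift.tmul, LinearMap.flip_apply,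
      hP m n t ht, ← ht]
    exact LinearMap.congr_fun
      (f := V ∘ₗ (Tri.joinRight ρ₁ l₁ ρN l₂).flip m ∘ₗ Bal.mk _ _)
      (g := G ∘ₗ (F ∘ₗ TensorProduct.mk k M N m).rTensor N)
      (TensorProduct.ext' fun a n => rfl) t
  rw [← LinearMap.comp_apply, ← e₁, ← e₂, LinearMap.comp_apply, LinearMap.comp_apply,
    h m x y hx hy]

/-- Cancellation of a convolution inverse.  If `f(n₁) g(n₂) = η(ε(n))` and `X(m q) = X(m) η(q)`,
then `Y(m) = X(m₀) f(m₁)`, formed with `δ₁`, determines `X` by `X(m) = Y(m₀) g(m₁)`, formed with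
`δ₂`. -/
theorem Coassociative.convolution_cancel (h : Coassociative δ₁ δ₂ Δ) {ε : N →ₗ[k] Q₁}
    (hε : RightCounital δ₁ ε) (α : Aᵐᵒᵖ →ₐ[k] Module.End k Z) (η : Q₁ →ₗ[k] A) (X : M →ₗ[k] Z)
    (hX : ∀ q m, X (ρ₁ (op q) m) = α (op (η q)) (X m)) (f g : N →ₗ[k] A)
    (hf : ∀ q n, f (l₁ q n) = η q * f n)
    (hfg : ∀ q n p, f (ρN (op q) n) * g p = f n * g (l₂ q p))
    (hconv : ∀ n t, Bal.mk ρN l₂ t = Δ n →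
      LinearMap.mul' k A (TensorProduct.map f g t) = η (ε n))
    (Y : M →ₗ[k] Z)
    (hY : ∀ m y, Bal.mk ρ₁ l₁ y = δ₁ m → Y m = actThrough α f (X.rTensor N y))
    (m : M) (x : M ⊗[k] N) (hx : Bal.mk ρ₂ l₂ x = δ₂ m) :
    actThrough α g (Y.rTensor N x) = X m := by
  obtain ⟨y, hy⟩ := Bal.mk_surjective (δ₁ m)
  have hmul : ∀ a b z, α (op b) (α (op a) z) = α (op (a * b)) z := fun a b z => by
    rw [op_mul, map_mul, Module.End.mul_apply]
  rw [h.apply (actThrough α f ∘ₗ X.rTensor N) (fun q m n => by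
      simp only [LinearMap.comp_apply, LinearMap.rTensor_tmul, actThrough_tmul, hX, hf, hmul])
    (actThrough α g) (fun q m n n' => by
      simp only [LinearMap.comp_apply, LinearMap.rTensor_tmul, actThrough_tmul, hmul, hfg]) Y hY
    (actThrough α (η ∘ₗ ε) ∘ₗ X.rTensor N) (fun m n t ht => ?_) m x y hx hy]
  · conv_rhs => rw [← hε m y hy]
    exact LinearMap.congr_fun (f := actThrough α (η ∘ₗ ε) ∘ₗ X.rTensor N)
      (g := X ∘ₗ actThrough ρ₁ ε) (TensorProduct.ext' fun m n => by simp [hX]) y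
  · simp only [LinearMap.comp_apply, LinearMap.rTensor_tmul, actThrough_tmul, ← hconv n t ht]
    exact LinearMap.congr_fun
      (f := (α.toLinearMap ∘ₗ (opLinearEquiv k : A ≃ₗ[k] Aᵐᵒᵖ).toLinearMap).flip (X m) ∘ₗ
        LinearMap.mul' k A ∘ₗ TensorProduct.map f g)
      (g := actThrough α g ∘ₗ
        ((actThrough α f ∘ₗ X.rTensor N) ∘ₗ TensorProduct.mk k M N m).rTensor N)
      (TensorProduct.ext' fun a b => by simp) t

end Convolution

/-! ### The diagonal action on `M ⊗_R H` -/

section DiagonalAction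

variable {k L R H A : Type*} [CommRing k] [Ring L] [Algebra k L] [Ring R] [Algebra k R]
  [Ring H] [Algebra k H] [Ring A] [Algebra k A]

@[simp] theorem diagAct_tmul {M : Type*} [AddCommGroup M] [Module k M]
    (α : Aᵐᵒᵖ →ₐ[k] Module.End k M) (m : M) (h : H) (a : A) (h' : H) :
    diagAct α (m ⊗ₜ h) (a ⊗ₜ h') = α (op a) m ⊗ₜ (h * h') := rfl

theorem diagAct_mul {M : Type*} [AddCommGroup M] [Module k M]
    (α : Aᵐᵒᵖ →ₐ[k] Module.End k M) (x : M ⊗[k] H) (y y' : A ⊗[k] H) :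
    diagAct α x (y * y') = diagAct α (diagAct α x y) y' := by
  induction x with
  | zero => simp
  | add x₁ x₂ h₁ h₂ => simp [h₁, h₂]
  | tmul m h =>
    induction y with
    | zero => simp
    | add y₁ y₂ h₁ h₂ => simp [h₁, h₂, add_mul]
    | tmul a c =>
      induction y' with
      | zero => simp
      | add y₁ y₂ h₁ h₂ => simp [h₁, h₂, mul_add]
      | tmul a' c' => simp [mul_assoc]

theorem diagAct_one {M : Type*} [AddCommGroup M] [Module k M]
    (α : Aᵐᵒᵖ →ₐ[k] Module.End k M) (x : M ⊗[k] H) : diagAct α x (1 ⊗ₜ[k] (1 : H)) = x :=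
  LinearMap.congr_fun (f := (diagAct α).flip (1 ⊗ₜ[k] (1 : H))) (g := LinearMap.id)
    (TensorProduct.ext' fun m h => by simp) x

theorem diagAct_lsmul (x y : A ⊗[k] H) : diagAct (Algebra.lsmul k k A) x y = x * y :=
  LinearMap.congr_fun₂ (f := diagAct (Algebra.lsmul k k A)) (g := LinearMap.mul k (A ⊗[k] H))
    (TensorProduct.ext' fun a h => TensorProduct.ext' fun a' h' => by simp) x y

variable {𝓗 : HopfAlgebroid k L R H} {𝓐 : ComoduleAlgebra 𝓗 A}

namespace RelHopfModule

/-- The map `(a ⊗_R h', m ⊗_k h) ↦ m a ⊗_R h h'`. -/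
noncomputable def diagMul (M : RelHopfModule 𝓐) :
    Bal 𝓐.actR (rmulAct 𝓗.HR.t) →ₗ[k] M.carrier ⊗[k] H →ₗ[k]
      Bal M.comod.actR (rmulAct 𝓗.HR.t) :=
  Bal.lift ((diagAct M.actA).flip.compr₂ (Bal.mk _ _)) fun r a h' =>
    TensorProduct.ext' fun m h => by
      have := Bal.mk_balanced (ρ := M.comod.actR) (l := rmulAct 𝓗.HR.t) r (M.actA (op a) m) (h * h')
      rw [← M.actA_ηR, ← Module.End.mul_apply, ← map_mul, ← op_mul] at this
      simpa [𝓐.actR_eq, mul_assoc] using this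

theorem diagMul_mk (M : RelHopfModule 𝓐) (y : A ⊗[k] H) (x : M.carrier ⊗[k] H) :
    M.diagMul (Bal.mk _ _ y) x = Bal.mk _ _ (diagAct M.actA x y) := rfl

theorem diagMul_coR_balanced (M : RelHopfModule 𝓐) (a : A) (r : R) (m : M.carrier) (h : H) :
    M.diagMul (𝓐.coR a) (M.comod.actR (op r) m ⊗ₜ h) =
      M.diagMul (𝓐.coR a) (m ⊗ₜ rmulAct 𝓗.HR.t r h) := by
  obtain ⟨y, hy⟩ := Bal.mk_surjective (𝓐.coR a)
  have e₁ : diagAct M.actA (M.comod.actR (op r) m ⊗ₜ h) y =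
      diagAct M.actA (m ⊗ₜ h) ((LinearMap.mulLeft k (𝓐.ηR r)).rTensor H y) := by
    rw [← tmul_one_mul, diagAct_mul, diagAct_tmul, M.actA_ηR, mul_one]
  have e₂ : diagAct M.actA (m ⊗ₜ rmulAct 𝓗.HR.t r h) y =
      diagAct M.actA (m ⊗ₜ h) ((LinearMap.mulLeft k (𝓗.HR.t (op r))).lTensor A y) := by
    rw [← one_tmul_mul, diagAct_mul, diagAct_tmul]
    simp
  rw [← hy, diagMul_mk, diagMul_mk, e₁, e₂, ← diagMul_mk, ← diagMul_mk,
    𝓐.coR_takeuchi a r y hy]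

/-- The diagonal right `A`-action `(m ⊗_R h) a = m a⁽⁰⁾ ⊗_R h a⁽¹⁾` on `M ⊗_R H`.  It is
well defined because the coaction of `A` takes values in the Takeuchi product. -/
noncomputable def tensorAct (M : RelHopfModule 𝓐) :
    Aᵐᵒᵖ →ₐ[k] Module.End k (Bal M.comod.actR (rmulAct 𝓗.HR.t)) :=
  AlgHom.ofLinearMap
    { toFun := fun a => Bal.lift (M.diagMul (𝓐.coR a.unop)) (M.diagMul_coR_balanced a.unop)
      map_add' := fun a b => Bal.hom_ext fun m h => by simp [ins]
      map_smul' := fun c a => Bal.hom_ext fun m h => by simp [ins] }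
    (Bal.hom_ext fun m h => by
      simp [ins, 𝓐.coR_one, diagMul_mk, diagAct_one])
    (fun a b => Bal.hom_ext fun m h => by
      obtain ⟨y, hy⟩ := Bal.mk_surjective (𝓐.coR a.unop)
      obtain ⟨y', hy'⟩ := Bal.mk_surjective (𝓐.coR b.unop)
      simp [ins, 𝓐.coR_mul _ _ _ _ hy' hy, ← hy, ← hy', diagMul_mk, diagAct_mul])

theorem tensorAct_mk (M : RelHopfModule 𝓐) {a : A} {y : A ⊗[k] H} (hy : Bal.mk _ _ y = 𝓐.coR a)
    (x : M.carrier ⊗[k] H) :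
    M.tensorAct (op a) (Bal.mk _ _ x) = Bal.mk _ _ (diagAct M.actA x y) := by
  rw [← diagMul_mk, hy]; rfl

/-- The coaction `ϱ_R` of a relative Hopf module is linear for the diagonal action. -/
theorem tensorAct_coR (M : RelHopfModule 𝓐) (a : A) (m : M.carrier) :
    M.tensorAct (op a) (M.comod.coR m) = M.comod.coR (M.actA (op a) m) := by
  obtain ⟨x, hx⟩ := Bal.mk_surjective (M.comod.coR m)
  obtain ⟨y, hy⟩ := Bal.mk_surjective (𝓐.coR a)
  rw [M.coR_act m a x y hx hy, ← hx, M.tensorAct_mk hy]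

end RelHopfModule

/-- The comodule algebra `A` as a relative Hopf module over itself. -/
noncomputable def ComoduleAlgebra.regular (𝓐 : ComoduleAlgebra 𝓗 A) : RelHopfModule 𝓐 where
  carrier := A
  comod := 𝓐.toHComodule
  actA := Algebra.lsmul k k A
  actA_ηR r m := (𝓐.actR_eq r m).symm
  coR_act m a x y hx hy := by
    rw [diagAct_lsmul]
    exact 𝓐.coR_mul m a x y hx hy
  coL_act m a x y hx hy := by
    rw [diagAct_lsmul]
    exact 𝓐.coL_mul m a x y hx hy

end DiagonalAction

/-! ### The projection onto the coinvariants -/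

section Projection

variable {k L R H A : Type*} [CommRing k] [Ring L] [Algebra k L] [Ring R] [Algebra k R]
  [Ring H] [Algebra k H] [Ring A] [Algebra k A]
  {𝓗 : HopfAlgebroid k L R H} {𝓐 : ComoduleAlgebra 𝓗 A}

theorem RelHopfModule.actA_actA (M : RelHopfModule 𝓐) (a b : A) (m : M.carrier) :
    M.actA (op b) (M.actA (op a) m) = M.actA (op (a * b)) m := by
  rw [op_mul, map_mul, Module.End.mul_apply]

namespace ComoduleAlgebra.Cleaving

variable (c : 𝓐.Cleaving)

theorem j_mul_sR (r : R) (h : H) : c.j (h * 𝓗.HR.s r) = c.j h * 𝓐.ηR r :=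
  (c.j_comod.map_actR r h).trans (𝓐.actR_eq r _)

theorem j_one_mem : c.j 1 ∈ 𝓐.B :=
  (c.j_comod.map_coR 1 (1 ⊗ₜ 1) 𝓗.HR.comul_one.symm).trans (by simp)

theorem jt_one_mul_j_one : c.jt 1 * c.j 1 = 1 := by
  have h1 : 𝓗.HR.ε 1 = 1 := by simpa using 𝓗.HR.counit_one 1
  simpa [h1] using c.jt_mul_j 1 (1 ⊗ₜ 1) 𝓗.HL.comul_one.symm

/-- The map `π(m) = m⁽⁰⁾ j̃(m⁽¹⁾)`, as an endomorphism of the underlying `k`-module. -/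
noncomputable def proj (M : RelHopfModule 𝓐) : M.carrier →ₗ[k] M.carrier :=
  Bal.lift (ρ := M.comod.actR) (l := rmulAct 𝓗.HR.t) (actThrough M.actA c.jt) (fun r m h => by
    simp [-op_mul, ← M.actA_ηR, M.actA_actA, c.jt_left]) ∘ₗ M.comod.coR

theorem proj_eq {M : RelHopfModule 𝓐} {m : M.carrier} {x : M.carrier ⊗[k] H}
    (hx : Bal.mk _ _ x = M.comod.coR m) : c.proj M m = actThrough M.actA c.jt x := by
  rw [proj, LinearMap.comp_apply, ← hx, Bal.lift_mk]

theorem proj_actL (M : RelHopfModule 𝓐) (l : L) (m : M.carrier) :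
    c.proj M (M.comod.actL (op l) m) = M.actA (op (c.ηL l)) (c.proj M m) := by
  obtain ⟨x, hx⟩ := Bal.mk_surjective (M.comod.coR m)
  rw [c.proj_eq (M.comod.coR_linearL l m x hx).symm, c.proj_eq hx]
  exact LinearMap.congr_fun
    (f := actThrough M.actA c.jt ∘ₗ (lmulAct 𝓗.HL.t (op l)).lTensor M.carrier)
    (g := M.actA (op (c.ηL l)) ∘ₗ actThrough M.actA c.jt)
    (TensorProduct.ext' fun m h => by simp [-op_mul, M.actA_actA, c.jt_right]) x

/-- `π(m₍₀₎) j(m₍₁₎) = m`. -/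
theorem proj_mul_j (M : RelHopfModule 𝓐) (m : M.carrier) (x : M.carrier ⊗[k] H)
    (hx : Bal.mk _ _ x = M.comod.coL m) :
    actThrough M.actA c.j ((c.proj M).rTensor H x) = m :=
  M.comod.coassoc_RL.convolution_cancel M.comod.isCoactionR.counital M.actA 𝓐.ηR.toLinearMap
    LinearMap.id (fun r m => (M.actA_ηR r m).symm) c.jt c.j c.jt_left
    (fun l n p => by
      rw [lmulAct_apply, lmulAct_apply, c.jt_right, c.j_left, mul_assoc])
    c.jt_mul_j (c.proj M) (fun m y hy => by rw [c.proj_eq hy, LinearMap.rTensor_id_apply]) m x hx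

/-- `ϱ_R(π(m₍₀₎)) j(m₍₁₎) = ϱ_R(m)` for the diagonal action, since `ϱ_R` is `A`-linear. -/
theorem actThrough_coR_proj (M : RelHopfModule 𝓐) (m : M.carrier) (y : M.carrier ⊗[k] H)
    (hy : Bal.mk _ _ y = M.comod.coL m) :
    actThrough M.tensorAct c.j ((M.comod.coR ∘ₗ c.proj M).rTensor H y) = M.comod.coR m := by
  conv_rhs => rw [← c.proj_mul_j M m y hy]
  exact LinearMap.congr_fun
    (f := actThrough M.tensorAct c.j ∘ₗ (M.comod.coR ∘ₗ c.proj M).rTensor H)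
    (g := M.comod.coR ∘ₗ actThrough M.actA c.j ∘ₗ (c.proj M).rTensor H)
    (TensorProduct.ext' fun n h => by simp [M.tensorAct_coR]) y

/-- `(π(m₍₀₎) ⊗ 1) j(m₍₁₎) = ϱ_R(m)` for the diagonal action: colinearity of `j` turns the left
side into `π(m₍₀₎) j(m₍₁₎⁽¹⁾) ⊗ m₍₁₎⁽²⁾`, and mixed coassociativity into
`π(m⁽⁰⁾₍₀₎) j(m⁽⁰⁾₍₁₎) ⊗ m⁽¹⁾`. -/
theorem actThrough_proj_tmul_one (M : RelHopfModule 𝓐) (m : M.carrier) (y : M.carrier ⊗[k] H)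
    (hy : Bal.mk _ _ y = M.comod.coL m) :
    actThrough M.tensorAct c.j
      (((Bal.mk M.comod.actR (rmulAct 𝓗.HR.t) ∘ₗ (TensorProduct.mk k M.carrier H).flip 1) ∘ₗ
        c.proj M).rTensor H y) = M.comod.coR m := by
  obtain ⟨x, hx⟩ := Bal.mk_surjective (M.comod.coR m)
  refine Eq.trans (Eq.symm (M.comod.coassoc_LR.apply
    (actThrough M.actA c.j ∘ₗ (c.proj M).rTensor H)
    (fun l m n => by simp [-op_mul, c.proj_actL, c.j_left, M.actA_actA])
    (Bal.mk M.comod.actR (rmulAct 𝓗.HR.t))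
    (fun r m n n' => ?_) LinearMap.id (fun m y hy => (c.proj_mul_j M m y hy).symm)
    (actThrough M.tensorAct c.j ∘ₗ ((Bal.mk M.comod.actR (rmulAct 𝓗.HR.t) ∘ₗ
      (TensorProduct.mk k M.carrier H).flip 1) ∘ₗ c.proj M).rTensor H)
    (fun m n t ht => ?_) m x y hx hy)) (by rw [LinearMap.rTensor_id_apply, hx])
  · rw [← Bal.mk_balanced]
    simp [c.j_mul_sR, M.actA_ηR]
  · simp only [LinearMap.comp_apply, LinearMap.rTensor_tmul, LinearMap.flip_apply,
      TensorProduct.mk_apply, actThrough_tmul]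
    rw [M.tensorAct_mk (c.j_comod.map_coR n t ht).symm]
    congr 1
    exact LinearMap.congr_fun
      (f := diagAct M.actA (c.proj M m ⊗ₜ 1) ∘ₗ c.j.rTensor H)
      (g := ((actThrough M.actA c.j ∘ₗ (c.proj M).rTensor H) ∘ₗ
        TensorProduct.mk k M.carrier H m).rTensor H)
      (TensorProduct.ext' fun a b => by simp) t

/-- `π(m)` is coinvariant.  For `X(m) = ϱ_R(π(m)) - π(m) ⊗ 1` one has `X(m₍₀₎) j(m₍₁₎) = 0` in the
right `A`-module `M ⊗_R H`, and convolution with `j̃` gives `X = 0`. -/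
theorem proj_mem_coinv (M : RelHopfModule 𝓐) (m : M.carrier) : c.proj M m ∈ M.coinv := by
  obtain ⟨x, hx⟩ := Bal.mk_surjective (M.comod.coR m)
  -- the map `n ↦ n ⊗ 1`
  let I := Bal.mk M.comod.actR (rmulAct 𝓗.HR.t) ∘ₗ (TensorProduct.mk k M.carrier H).flip 1
  have key := M.comod.coassoc_LR.convolution_cancel M.comod.isCoactionL.counital M.tensorAct
    c.ηL.toLinearMap (M.comod.coR ∘ₗ c.proj M - I ∘ₗ c.proj M) (fun l m => ?_) c.j c.jt c.j_left
    (fun r n p => by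
      rw [rmulActOp_apply, rmulAct_apply, c.jt_left, c.j_mul_sR, mul_assoc])
    c.j_mul_jt 0 (fun m y hy => ?_) m x hx
  · rw [LinearMap.rTensor_zero, LinearMap.zero_apply, map_zero] at key
    exact sub_eq_zero.1 key.symm
  · -- `X(m l) = X(m) η_L(l)`, because the values of `η_L` are coinvariant
    have hI : ∀ n, M.tensorAct (op (c.ηL l)) (I n) = I (M.actA (op (c.ηL l)) n) := fun n => by
      refine (M.tensorAct_mk (Eq.symm (c.ηL_mem l)) _).trans ?_
      simp [I]
    simp [c.proj_actL, ← M.tensorAct_coR, hI]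
  · rw [LinearMap.rTensor_sub, LinearMap.sub_apply, map_sub, c.actThrough_coR_proj M m y hy,
      c.actThrough_proj_tmul_one M m y hy, sub_self, LinearMap.zero_apply]

/-- `π(n) j(1) = n j̃(1) j(1) = n` for a coinvariant `n`. -/
theorem proj_coinv_mul_j_one (M : RelHopfModule 𝓐) {n : M.carrier} (hn : n ∈ M.coinv) :
    M.actA (op (c.j 1)) (c.proj M n) = n := by
  rw [c.proj_eq (Eq.symm hn), actThrough_tmul, M.actA_actA, c.jt_one_mul_j_one]
  simp

/-- The map `π(a) = a⁽⁰⁾ j̃(a⁽¹⁾)` on the comodule algebra `A`. -/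
noncomputable def projA : A →ₗ[k] A := c.proj 𝓐.regular

theorem projA_eq {a : A} {x : A ⊗[k] H} (hx : Bal.mk _ _ x = 𝓐.coR a) :
    c.projA a = LinearMap.mul' k A (c.jt.lTensor A x) :=
  (c.proj_eq (M := 𝓐.regular) hx).trans
    (LinearMap.congr_fun (f := actThrough 𝓐.regular.actA c.jt)
      (g := LinearMap.mul' k A ∘ₗ c.jt.lTensor A) (TensorProduct.ext' fun _ _ => rfl) x)

theorem projA_mem (a : A) : c.projA a ∈ 𝓐.B := c.proj_mem_coinv 𝓐.regular a

/-- `π(n a) = n π(a)` for a coinvariant `n`. -/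
theorem proj_actA (M : RelHopfModule 𝓐) {n : M.carrier} (hn : n ∈ M.coinv) (a : A) :
    c.proj M (M.actA (op a) n) = M.actA (op (c.projA a)) n := by
  obtain ⟨y, hy⟩ := Bal.mk_surjective (𝓐.coR a)
  rw [c.proj_eq (M.coR_act n a _ y (Eq.symm hn) hy).symm, c.projA_eq hy]
  exact LinearMap.congr_fun (f := actThrough M.actA c.jt ∘ₗ diagAct M.actA (n ⊗ₜ 1))
    (g := (M.actA.toLinearMap ∘ₗ (opLinearEquiv k : A ≃ₗ[k] Aᵐᵒᵖ).toLinearMap).flip n ∘ₗ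
      LinearMap.mul' k A ∘ₗ c.jt.lTensor A)
    (TensorProduct.ext' fun b h => by simp) y

theorem projA_mul {b : A} (hb : b ∈ 𝓐.B) (a : A) : c.projA (b * a) = b * c.projA a :=
  c.proj_actA 𝓐.regular (n := b) hb a

/-- The retraction `θ(a) = a⁽⁰⁾ j̃(a⁽¹⁾) j(1)` of the inclusion `B ⊆ A`. -/
noncomputable def retraction : A →ₗ[k] 𝓐.B :=
  ((LinearMap.mulRight k (c.j 1)) ∘ₗ c.projA).codRestrict
    (Subalgebra.toSubmodule 𝓐.B) fun a => 𝓐.B.mul_mem (c.projA_mem a) c.j_one_mem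

theorem coe_retraction (a : A) : (c.retraction a : A) = c.projA a * c.j 1 := rfl

/-- `π(n a) j(1) = n θ(a)` for a coinvariant `n`. -/
theorem proj_actA_mul_j_one (M : RelHopfModule 𝓐) {n : M.carrier} (hn : n ∈ M.coinv) (a : A) :
    M.actA (op (c.j 1)) (c.proj M (M.actA (op a) n)) = M.actA (op (c.retraction a : A)) n := by
  rw [c.proj_actA M hn, M.actA_actA, c.coe_retraction]

theorem retraction_mul (b : 𝓐.B) (a : A) : c.retraction (b * a) = b * c.retraction a :=
  Subtype.ext (by
    rw [coe_retraction, c.projA_mul b.2, Subalgebra.coe_mul, coe_retraction, mul_assoc])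

theorem retraction_one : c.retraction 1 = 1 :=
  Subtype.ext (by
    rw [coe_retraction, c.projA_eq 𝓐.coR_one.symm]
    simp [c.jt_one_mul_j_one])

end ComoduleAlgebra.Cleaving

end Projection

/-! ### The adjunction between induction and coinvariants -/

section Adjunction

variable {k L R H : Type*} {A : Type u} [CommRing k] [Ring L] [Algebra k L] [Ring R] [Algebra k R]
  [Ring H] [Algebra k H] [Ring A] [Algebra k A]
  {𝓗 : HopfAlgebroid k L R H} {𝓐 : ComoduleAlgebra 𝓗 A}

theorem indRelHopfModule_coR_ins {W : Type*} [AddCommGroup W] [Module k W]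
    (ω : (𝓐.B)ᵐᵒᵖ →ₐ[k] Module.End k W) (w : W) {a : A} {x : A ⊗[k] H}
    (hx : Bal.mk _ _ x = 𝓐.coR a) :
    (indRelHopfModule 𝓐 ω).comod.coR (ins ω 𝓐.leftB w a) =
      Bal.mk _ _ ((ins ω 𝓐.leftB w).rTensor H x) :=
  indCo_ins _ 𝓐.actR_leftB 𝓐.colinear_leftB_R w a x hx

theorem indRelHopfModule_coL_ins {W : Type*} [AddCommGroup W] [Module k W]
    (ω : (𝓐.B)ᵐᵒᵖ →ₐ[k] Module.End k W) (w : W) {a : A} {x : A ⊗[k] H}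
    (hx : Bal.mk _ _ x = 𝓐.coL a) :
    (indRelHopfModule 𝓐 ω).comod.coL (ins ω 𝓐.leftB w a) =
      Bal.mk _ _ ((ins ω 𝓐.leftB w).rTensor H x) :=
  indCo_ins _ 𝓐.actL_leftB 𝓐.colinear_leftB_L w a x hx

theorem ins_one_mem_coinv {W : Type*} [AddCommGroup W] [Module k W]
    (ω : (𝓐.B)ᵐᵒᵖ →ₐ[k] Module.End k W) (w : W) :
    ins ω 𝓐.leftB w 1 ∈ (indRelHopfModule 𝓐 ω).coinv :=
  indRelHopfModule_coR_ins ω w 𝓐.coR_one.symm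

/-- The inclusion `M^{co H_R} → M`. -/
def coinvIncl (M : RelHopfModule.{v} 𝓐) : (coinvariants 𝓐).obj M →ₗ[k] M.carrier where
  toFun := coinvVal M
  map_add' _ _ := rfl
  map_smul' c n := by
    change M.actA (op (algebraMap k A c)) (coinvVal M n) = _
    rw [← MulOpposite.algebraMap_apply, AlgHom.commutes]
    rfl

@[simp] theorem coinvIncl_apply (M : RelHopfModule.{v} 𝓐) (n : (coinvariants 𝓐).obj M) :
    coinvIncl M n = coinvVal M n := rfl

theorem coinvVal_mem (M : RelHopfModule.{v} 𝓐) (n : (coinvariants 𝓐).obj M) :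
    coinvVal M n ∈ M.coinv := n.2

theorem coinvVal_injective (M : RelHopfModule.{v} 𝓐) : Function.Injective (coinvVal M) :=
  Subtype.val_injective

theorem coinvVal_smul (M : RelHopfModule.{v} 𝓐) (b : 𝓐.B) (n : (coinvariants 𝓐).obj M) :
    coinvVal M (op b • n) = M.actA (op (b : A)) (coinvVal M n) := rfl

/-- The `k`-linear map `M^{co H_R} ⊗_B A → M`, `n ⊗ a ↦ n a`. -/
noncomputable def counitLin (M : RelHopfModule.{v} 𝓐) :
    Bal (actB 𝓐 ((coinvariants 𝓐).obj M)) 𝓐.leftB →ₗ[k] M.carrier :=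
  Bal.lift (actThrough M.actA LinearMap.id ∘ₗ (coinvIncl M).rTensor A) fun b n a => by
    simp only [LinearMap.comp_apply, LinearMap.rTensor_tmul, actB_apply, coinvIncl_apply,
      coinvVal_smul, actThrough_tmul, LinearMap.id_apply, M.actA_actA, ComoduleAlgebra.leftB_apply]

theorem counitLin_ins (M : RelHopfModule.{v} 𝓐) (n : (coinvariants 𝓐).obj M) (a : A) :
    counitLin M (ins _ 𝓐.leftB n a) = M.actA (op a) (coinvVal M n) := rfl

theorem counitLin_comp_ins (M : RelHopfModule.{v} 𝓐) (n : (coinvariants 𝓐).obj M)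
    (x : A ⊗[k] H) :
    (counitLin M).rTensor H ((ins _ 𝓐.leftB n).rTensor H x) =
      diagAct M.actA (coinvVal M n ⊗ₜ 1) x :=
  LinearMap.congr_fun (f := (counitLin M).rTensor H ∘ₗ (ins _ 𝓐.leftB n).rTensor H)
    (g := diagAct M.actA (coinvVal M n ⊗ₜ 1))
    (TensorProduct.ext' fun a h => by simp [counitLin_ins]) x

/-- `ϱ_R(n a) = n a⁽⁰⁾ ⊗_R a⁽¹⁾` for a coinvariant `n`. -/
theorem RelHopfModule.coR_actA (M : RelHopfModule 𝓐) {n : M.carrier} (hn : n ∈ M.coinv) {a : A}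
    {x : A ⊗[k] H} (hx : Bal.mk _ _ x = 𝓐.coR a) :
    M.comod.coR (M.actA (op a) n) = Bal.mk _ _ (diagAct M.actA (n ⊗ₜ 1) x) :=
  M.coR_act n a _ x (Eq.symm hn) hx

/-- `ϱ_L(n a) = n a₍₀₎ ⊗_L a₍₁₎` for a coinvariant `n`. -/
theorem RelHopfModule.coL_actA (M : RelHopfModule 𝓐) {n : M.carrier} (hn : n ∈ M.coinv) {a : A}
    {x : A ⊗[k] H} (hx : Bal.mk _ _ x = 𝓐.coL a) :
    M.comod.coL (M.actA (op a) n) = Bal.mk _ _ (diagAct M.actA (n ⊗ₜ 1) x) :=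
  M.coL_act n a _ x (M.comod.coL_of_coR hn).symm hx

/-- On coinvariants the right `L`-action passes to `A`; for a general element of `M` it does
not. -/
theorem RelHopfModule.actL_actA (M : RelHopfModule 𝓐) {n : M.carrier} (hn : n ∈ M.coinv) (l : L)
    (a : A) : M.comod.actL (op l) (M.actA (op a) n) = M.actA (op (𝓐.actL (op l) a)) n := by
  apply M.comod.coR_injective
  obtain ⟨y, hy⟩ := Bal.mk_surjective (𝓐.coR a)
  rw [M.comod.coR_linearL l _ _ (M.coR_actA hn hy).symm,
    M.coR_actA hn (𝓐.coR_linearL l a y hy).symm]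
  congr 1
  exact LinearMap.congr_fun
    (f := (lmulAct 𝓗.HL.t (op l)).lTensor M.carrier ∘ₗ diagAct M.actA (n ⊗ₜ 1))
    (g := diagAct M.actA (n ⊗ₜ 1) ∘ₗ (lmulAct 𝓗.HL.t (op l)).lTensor A)
    (TensorProduct.ext' fun a h => by simp) y

theorem counitLin_isComoduleHom (M : RelHopfModule.{v} 𝓐) :
    IsComoduleHom (𝓐.indComod (actB 𝓐 ((coinvariants 𝓐).obj M))) M.comod (counitLin M) := by
  have hR : ∀ (r : R) m, counitLin M ((𝓐.indComod (actB 𝓐 _)).actR (op r) m) =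
      M.comod.actR (op r) (counitLin M m) := fun r m =>
    LinearMap.congr_fun
      (f := counitLin M ∘ₗ (𝓐.indComod (actB 𝓐 ((coinvariants 𝓐).obj M))).actR (op r))
      (g := M.comod.actR (op r) ∘ₗ counitLin M) (Bal.hom_ext fun n a => by
        change M.actA (op (𝓐.actR (op r) a)) (coinvVal M n) =
          M.comod.actR (op r) (M.actA (op a) (coinvVal M n))
        rw [← M.actA_ηR, M.actA_actA, 𝓐.actR_eq]) m
  have hL : ∀ (l : L) m, counitLin M ((𝓐.indComod (actB 𝓐 _)).actL (op l) m) =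
      M.comod.actL (op l) (counitLin M m) := fun l m =>
    LinearMap.congr_fun
      (f := counitLin M ∘ₗ (𝓐.indComod (actB 𝓐 ((coinvariants 𝓐).obj M))).actL (op l))
      (g := M.comod.actL (op l) ∘ₗ counitLin M) (Bal.hom_ext fun n a =>
        (M.actL_actA (coinvVal_mem M n) l a).symm) m
  refine ⟨hR, hL, fun m x hx => ?_, fun m x hx => ?_⟩
  · symm
    refine rep_ind (𝓐.indComod (actB 𝓐 _)).coR (Bal.mk _ _ ∘ₗ (counitLin M).rTensor H)
      (fun r m h => ?_) (M.comod.coR ∘ₗ counitLin M) (fun n a => ?_) m x hx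
    · simp only [LinearMap.comp_apply, LinearMap.rTensor_tmul, hR, Bal.mk_balanced]
    · obtain ⟨t, ht⟩ := Bal.mk_surjective (𝓐.coR a)
      refine ⟨_, (indRelHopfModule_coR_ins _ n ht).symm, ?_⟩
      rw [LinearMap.comp_apply, LinearMap.comp_apply, counitLin_comp_ins, counitLin_ins,
        M.coR_actA (coinvVal_mem M n) ht]
  · symm
    refine rep_ind (𝓐.indComod (actB 𝓐 _)).coL (Bal.mk _ _ ∘ₗ (counitLin M).rTensor H)
      (fun r m h => ?_) (M.comod.coL ∘ₗ counitLin M) (fun n a => ?_) m x hx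
    · simp only [LinearMap.comp_apply, LinearMap.rTensor_tmul, hL, Bal.mk_balanced]
    · obtain ⟨t, ht⟩ := Bal.mk_surjective (𝓐.coL a)
      refine ⟨_, (indRelHopfModule_coL_ins _ n ht).symm, ?_⟩
      rw [LinearMap.comp_apply, LinearMap.comp_apply, counitLin_comp_ins, counitLin_ins,
        M.coL_actA (coinvVal_mem M n) ht]

/-- The counit `c_M : M^{co H_R} ⊗_B A → M`, `n ⊗ a ↦ n a`. -/
noncomputable def counitHom (M : RelHopfModule.{max v u} 𝓐) :
    (induction.{v} 𝓐).obj ((coinvariants 𝓐).obj M) ⟶ M where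
  toLin := counitLin M
  map_actA a m := LinearMap.congr_fun
    (f := counitLin M ∘ₗ indActA 𝓐 (actB 𝓐 _) (op a)) (g := M.actA (op a) ∘ₗ counitLin M)
    (Bal.hom_ext fun n a' => (M.actA_actA a' a (coinvVal M n)).symm) m
  comod := counitLin_isComoduleHom M

/-- The unit `e_W : W → (W ⊗_B A)^{co H_R}`, `w ↦ w ⊗ 1`. -/
noncomputable def unitHom (W : ModuleCat.{max v u} (𝓐.B)ᵐᵒᵖ) :
    W ⟶ (coinvariants 𝓐).obj ((induction.{v} 𝓐).obj W) :=
  ModuleCat.ofHom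
    { toFun := fun w => ⟨ins (actB 𝓐 W) 𝓐.leftB w 1, ins_one_mem_coinv _ w⟩
      map_add' := fun w w' => Subtype.ext (by
        change ins (actB 𝓐 W) 𝓐.leftB (w + w') 1 =
          ins (actB 𝓐 W) 𝓐.leftB w 1 + ins (actB 𝓐 W) 𝓐.leftB w' 1
        simp [ins])
      map_smul' := fun b w => Subtype.ext (by
        refine (Bal.mk_balanced (ρ := actB 𝓐 W) (l := 𝓐.leftB) b.unop w 1).trans ?_
        change ins (actB 𝓐 W) 𝓐.leftB w ((b.unop : A) * 1) =
          ins (actB 𝓐 W) 𝓐.leftB w (1 * (b.unop : A))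
        rw [mul_one, one_mul]) }

theorem coinvVal_unitHom (W : ModuleCat.{max v u} (𝓐.B)ᵐᵒᵖ) (w : W) :
    coinvVal ((induction.{v} 𝓐).obj W) (unitHom.{v} W w) = ins (actB 𝓐 W) 𝓐.leftB w 1 := rfl

/-- Induction `- ⊗_B A` is left adjoint to the coinvariants functor, for every comodule
algebra. -/
noncomputable def inductionAdjunction (𝓐 : ComoduleAlgebra 𝓗 A) :
    induction.{v} 𝓐 ⊣ coinvariants.{max v u} 𝓐 where
  unit := { app := unitHom.{v}, naturality := fun _ _ _ => rfl }
  counit :=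
    { app := counitHom.{v}
      naturality := fun M N f => RelHopfModule.Hom.ext (Bal.hom_ext fun n a =>
        (f.map_actA a (coinvVal M n)).symm) }
  left_triangle_components W := RelHopfModule.Hom.ext (Bal.hom_ext fun w a => by
    change ins (actB 𝓐 W) 𝓐.leftB w (1 * a) = ins (actB 𝓐 W) 𝓐.leftB w a
    rw [one_mul])
  right_triangle_components M := by
    ext n
    refine coinvVal_injective M ?_
    change M.actA (op 1) (coinvVal M n) = coinvVal M n
    simp

/-- The inverse of a bijective morphism of relative Hopf modules. -/
def RelHopfModule.Hom.inv {M N : RelHopfModule.{v} 𝓐} (f : M ⟶ N) (g : N.carrier →ₗ[k] M.carrier)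
    (hfg : f.toLin ∘ₗ g = LinearMap.id) (hgf : g ∘ₗ f.toLin = LinearMap.id) : N ⟶ M :=
  have h₁ : ∀ n, f.toLin (g n) = n := LinearMap.congr_fun hfg
  have h₂ : ∀ m, g (f.toLin m) = m := LinearMap.congr_fun hgf
  have hR : ∀ (r : R) n, g (N.comod.actR (op r) n) = M.comod.actR (op r) (g n) := fun r n => by
    rw [← h₂ (M.comod.actR _ _), f.comod.map_actR, h₁]
  have hL : ∀ (l : L) n, g (N.comod.actL (op l) n) = M.comod.actL (op l) (g n) := fun l n => by
    rw [← h₂ (M.comod.actL _ _), f.comod.map_actL, h₁]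
  { toLin := g
    map_actA := fun a n => by rw [← h₂ (M.actA _ _), f.map_actA, h₁]
    comod :=
      { map_actR := hR
        map_actL := hL
        map_coR := fun n x hx => by
          obtain ⟨z, hz⟩ := Bal.mk_surjective (M.comod.coR (g n))
          have := f.comod.map_coR _ z hz
          rw [h₁, ← hx] at this
          have := congrArg (Bal.mapLeft (rmulAct 𝓗.HR.t) g hR) this
          rw [Bal.mapLeft_mk, Bal.mapLeft_mk, ← LinearMap.rTensor_comp_apply, hgf,
            LinearMap.rTensor_id_apply, hz] at this
          exact this.symm
        map_coL := fun n x hx => by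
          obtain ⟨z, hz⟩ := Bal.mk_surjective (M.comod.coL (g n))
          have := f.comod.map_coL _ z hz
          rw [h₁, ← hx] at this
          have := congrArg (Bal.mapLeft (lmulAct 𝓗.HL.s) g hL) this
          rw [Bal.mapLeft_mk, Bal.mapLeft_mk, ← LinearMap.rTensor_comp_apply, hgf,
            LinearMap.rTensor_id_apply, hz] at this
          exact this.symm } }

end Adjunction

/-! ### The inverses of the counit and of the unit -/

section Inverses

variable {k L R H : Type*} {A : Type u} [CommRing k] [Ring L] [Algebra k L] [Ring R] [Algebra k R]
  [Ring H] [Algebra k H] [Ring A] [Algebra k A]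
  {𝓗 : HopfAlgebroid k L R H} {𝓐 : ComoduleAlgebra 𝓗 A}

namespace ComoduleAlgebra.Cleaving

variable (c : 𝓐.Cleaving)

/-- The map `π(m) = m⁽⁰⁾ j̃(m⁽¹⁾)` with values in the coinvariants. -/
noncomputable def projCoinv (M : RelHopfModule.{v} 𝓐) :
    M.carrier →ₗ[k] (coinvariants 𝓐).obj M where
  toFun m := ⟨c.proj M m, c.proj_mem_coinv M m⟩
  map_add' m m' := coinvVal_injective M (map_add (c.proj M) m m')
  map_smul' r m := coinvVal_injective M <| by
    let n : (coinvariants 𝓐).obj M := ⟨c.proj M m, c.proj_mem_coinv M m⟩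
    exact (map_smul (c.proj M) r m).trans (map_smul (coinvIncl M) r n).symm

/-- `π(m l) = π(m) η_L(l)`; this makes `π(m₍₀₎) ⊗_B j(m₍₁₎)` well defined. -/
theorem projCoinv_actL (M : RelHopfModule.{v} 𝓐) (l : L) (m : M.carrier) :
    c.projCoinv M (M.comod.actL (op l) m) =
      actB 𝓐 ((coinvariants 𝓐).obj M) (op ⟨c.ηL l, c.ηL_mem l⟩) (c.projCoinv M m) :=
  coinvVal_injective M (c.proj_actL M l m)

theorem projCoinv_actA (M : RelHopfModule.{v} 𝓐) (n : (coinvariants 𝓐).obj M) (a : A) :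
    c.projCoinv M (M.actA (op a) (coinvVal M n)) =
      actB 𝓐 ((coinvariants 𝓐).obj M) (op ⟨c.projA a, c.projA_mem a⟩) n :=
  coinvVal_injective M (c.proj_actA M (coinvVal_mem M n) a)

/-- The map `m ↦ π(m₍₀₎) ⊗_B j(m₍₁₎)`. -/
noncomputable def counitInv (M : RelHopfModule.{v} 𝓐) :
    M.carrier →ₗ[k] Bal (actB 𝓐 ((coinvariants 𝓐).obj M)) 𝓐.leftB :=
  Bal.lift (ρ := M.comod.actL) (l := lmulAct 𝓗.HL.s)
    (Bal.mk _ _ ∘ₗ TensorProduct.map (c.projCoinv M) c.j) (fun l m h => by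
      simp only [LinearMap.comp_apply, TensorProduct.map_tmul]
      rw [c.projCoinv_actL, Bal.mk_balanced, lmulAct_apply, c.j_left]
      rfl) ∘ₗ M.comod.coL

theorem counitInv_eq {M : RelHopfModule.{v} 𝓐} {m : M.carrier} {x : M.carrier ⊗[k] H}
    (hx : Bal.mk _ _ x = M.comod.coL m) :
    c.counitInv M m = Bal.mk _ _ (TensorProduct.map (c.projCoinv M) c.j x) := by
  rw [counitInv, LinearMap.comp_apply, ← hx, Bal.lift_mk, LinearMap.comp_apply]

theorem counitLin_comp_counitInv (M : RelHopfModule.{v} 𝓐) :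
    counitLin M ∘ₗ c.counitInv M = LinearMap.id := by
  ext m
  obtain ⟨x, hx⟩ := Bal.mk_surjective (M.comod.coL m)
  rw [LinearMap.comp_apply, c.counitInv_eq hx, LinearMap.id_apply]
  conv_rhs => rw [← c.proj_mul_j M m x hx]
  exact LinearMap.congr_fun
    (f := counitLin M ∘ₗ Bal.mk _ _ ∘ₗ TensorProduct.map (c.projCoinv M) c.j)
    (g := actThrough M.actA c.j ∘ₗ (c.proj M).rTensor H) (TensorProduct.ext' fun m h => rfl) x

theorem counitInv_comp_counitLin (M : RelHopfModule.{v} 𝓐) :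
    c.counitInv M ∘ₗ counitLin M = LinearMap.id := by
  refine Bal.hom_ext fun n a => ?_
  obtain ⟨x, hx⟩ := Bal.mk_surjective (𝓐.coL a)
  rw [LinearMap.comp_apply, counitLin_ins, c.counitInv_eq (M.coL_actA (coinvVal_mem M n) hx).symm,
    LinearMap.id_apply]
  conv_rhs => rw [← c.proj_mul_j 𝓐.regular a x hx]
  refine LinearMap.congr_fun
    (f := Bal.mk (actB 𝓐 ((coinvariants 𝓐).obj M)) 𝓐.leftB ∘ₗ
      TensorProduct.map (c.projCoinv M) c.j ∘ₗ diagAct M.actA (coinvVal M n ⊗ₜ 1))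
    (g := ins (actB 𝓐 ((coinvariants 𝓐).obj M)) 𝓐.leftB n ∘ₗ LinearMap.mul' k A ∘ₗ
      TensorProduct.map c.projA c.j)
    (TensorProduct.ext' fun a h => ?_) x |>.trans ?_
  · simp only [LinearMap.comp_apply, diagAct_tmul, TensorProduct.map_tmul, one_mul,
      c.projCoinv_actA, Bal.mk_balanced]
    rfl
  · refine congrArg (ins (actB 𝓐 ((coinvariants 𝓐).obj M)) 𝓐.leftB n) ?_
    exact LinearMap.congr_fun (f := LinearMap.mul' k A ∘ₗ TensorProduct.map c.projA c.j)
      (g := actThrough 𝓐.regular.actA c.j ∘ₗ (c.proj 𝓐.regular).rTensor H)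
      (TensorProduct.ext' fun a h => rfl) x

/-- The map `W ⊗_B A → W`, `w ⊗ a ↦ w θ(a)`. -/
noncomputable def unitInvLin (W : ModuleCat.{v} (𝓐.B)ᵐᵒᵖ) :
    Bal (actB 𝓐 W) 𝓐.leftB →ₗ[k] W :=
  Bal.lift (actVia c.retraction W) fun b w a => by
    change op (c.retraction a) • op b • w = op (c.retraction (b * a)) • w
    rw [c.retraction_mul, op_mul, mul_smul]

theorem unitInvLin_ins (W : ModuleCat.{v} (𝓐.B)ᵐᵒᵖ) (w : W) (a : A) :
    c.unitInvLin W (ins _ _ w a) = op (c.retraction a) • w := rfl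

/-- A coinvariant `y` of `W ⊗_B A` is `y j̃(1) j(1) = π(y) j(1)`, and
`π(w ⊗ a) j(1) = w ⊗ θ(a) = w θ(a) ⊗ 1`. -/
theorem ins_unitInvLin (W : ModuleCat.{v} (𝓐.B)ᵐᵒᵖ) {y : Bal (actB 𝓐 W) 𝓐.leftB}
    (hy : y ∈ (indRelHopfModule 𝓐 (actB 𝓐 W)).coinv) :
    ins (actB 𝓐 W) 𝓐.leftB (c.unitInvLin W y) 1 = y := by
  let M := indRelHopfModule 𝓐 (actB 𝓐 W)
  refine Eq.trans ?_ (c.proj_coinv_mul_j_one M hy)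
  refine LinearMap.congr_fun
    (f := Bal.mk (actB 𝓐 W) 𝓐.leftB ∘ₗ (TensorProduct.mk k W A).flip 1 ∘ₗ c.unitInvLin W)
    (g := M.actA (op (c.j 1)) ∘ₗ c.proj M) (Bal.hom_ext fun w a => ?_) y
  have h : ∀ a, M.actA (op a) (ins (actB 𝓐 W) 𝓐.leftB w 1) = ins (actB 𝓐 W) 𝓐.leftB w a :=
    fun a => congrArg (ins (actB 𝓐 W) 𝓐.leftB w) (one_mul a)
  have e := c.proj_actA_mul_j_one M (ins_one_mem_coinv (actB 𝓐 W) w) a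
  rw [h, h] at e
  refine Eq.trans ?_ e.symm
  refine (Bal.mk_balanced (ρ := actB 𝓐 W) (l := 𝓐.leftB) (c.retraction a) w 1).trans ?_
  exact congrArg (ins (actB 𝓐 W) 𝓐.leftB w) (mul_one (c.retraction a : A))

/-- The inverse `∑ w ⊗ a ↦ ∑ w θ(a)` of the unit. -/
noncomputable def unitInv (W : ModuleCat.{max v u} (𝓐.B)ᵐᵒᵖ) :
    (coinvariants 𝓐).obj ((induction.{v} 𝓐).obj W) ⟶ W :=
  ModuleCat.ofHom
    { toFun := fun y => c.unitInvLin W (coinvVal _ y)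
      map_add' := fun y y' => map_add (c.unitInvLin W) _ _
      map_smul' := fun b y => by
        -- linearity over `B` is inherited from the unit, which is onto
        obtain ⟨w, rfl⟩ : ∃ w, unitHom.{v} W w = y :=
          ⟨c.unitInvLin W (coinvVal _ y), coinvVal_injective _ (c.ins_unitInvLin W y.2)⟩
        have h : ∀ w, c.unitInvLin W (coinvVal _ (unitHom.{v} W w)) = w := fun w => by
          rw [coinvVal_unitHom, c.unitInvLin_ins, c.retraction_one, op_one, one_smul]
        refine (congrArg (fun z => c.unitInvLin W (coinvVal _ z))
          (map_smul (unitHom.{v} W).hom b w).symm).trans ?_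
        exact (h _).trans (congrArg (b • ·) (h w).symm) }

theorem unitHom_comp_unitInv (W : ModuleCat.{max v u} (𝓐.B)ᵐᵒᵖ) :
    unitHom.{v} W ≫ c.unitInv W = 𝟙 W := by
  ext w
  change c.unitInvLin W (ins _ _ w 1) = w
  rw [c.unitInvLin_ins, c.retraction_one, op_one, one_smul]

theorem unitInv_comp_unitHom (W : ModuleCat.{max v u} (𝓐.B)ᵐᵒᵖ) :
    c.unitInv W ≫ unitHom.{v} W = 𝟙 _ := by
  ext y
  exact coinvVal_injective _ (c.ins_unitInvLin W y.2)

/-- The inverse `m ↦ π(m₍₀₎) ⊗_B j(m₍₁₎)` of the counit, as a morphism of relative Hopf modules. -/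
noncomputable def counitInvHom (M : RelHopfModule.{max v u} 𝓐) :
    M ⟶ (induction.{v} 𝓐).obj ((coinvariants 𝓐).obj M) :=
  (counitHom.{v} M).inv (c.counitInv M) (c.counitLin_comp_counitInv M)
    (c.counitInv_comp_counitLin M)

theorem counitHom_comp_counitInvHom (M : RelHopfModule.{max v u} 𝓐) :
    counitHom.{v} M ≫ c.counitInvHom M = 𝟙 _ :=
  RelHopfModule.Hom.ext (c.counitInv_comp_counitLin M)

theorem counitInvHom_comp_counitHom (M : RelHopfModule.{max v u} 𝓐) :
    c.counitInvHom.{v} M ≫ counitHom.{v} M = 𝟙 _ :=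
  RelHopfModule.Hom.ext (c.counitLin_comp_counitInv M)

end ComoduleAlgebra.Cleaving

end Inverses

end HopfAlgd

theorem mainTheorem1 {k L R H : Type*} {A : Type u} [CommRing k] [Ring L] [Algebra k L] [Ring R] [Algebra k R]
    [Ring H] [Algebra k H] [Ring A] [Algebra k A]
    (𝓗 : HopfAlgd.HopfAlgebroid k L R H) (𝓐 : HopfAlgd.ComoduleAlgebra 𝓗 A)
    (hcleft : 𝓐.IsCleft) :
    (HopfAlgd.induction.{v} 𝓐).IsEquivalence ∧
    ∃ adj : HopfAlgd.induction.{v} 𝓐 ⊣ HopfAlgd.coinvariants.{max v u} 𝓐,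
      -- the unit is `w ↦ w ⊗ 1`
      (∀ (W : ModuleCat.{max v u} (𝓐.B)ᵐᵒᵖ) (x : W),
        HopfAlgd.coinvVal ((HopfAlgd.induction.{v} 𝓐).obj W) (adj.unit.app W x) =
          HopfAlgd.Bal.mk (HopfAlgd.actB 𝓐 W) 𝓐.leftB (x ⊗ₜ[k] 1)) ∧
      -- the counit is `n ⊗ a ↦ n a`
      (∀ (M : HopfAlgd.RelHopfModule.{max v u} 𝓐) (n : (HopfAlgd.coinvariants 𝓐).obj M) (a : A),
        (adj.counit.app M).toLin
            (HopfAlgd.Bal.mk (HopfAlgd.actB 𝓐 _) 𝓐.leftB (n ⊗ₜ[k] a)) =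
          M.actA (op a) (HopfAlgd.coinvVal M n)) ∧
      ∀ c : 𝓐.Cleaving,
        -- the inverse of the counit is `m ↦ π(m₍₀₎) ⊗ j(m₍₁₎)` with `π(m) = m⁽⁰⁾ j̃(m⁽¹⁾)`
        (∀ M : HopfAlgd.RelHopfModule.{max v u} 𝓐,
          ∃ (π : M.carrier →ₗ[k] (HopfAlgd.coinvariants 𝓐).obj M)
            (d : M ⟶ (HopfAlgd.induction.{v} 𝓐).obj ((HopfAlgd.coinvariants 𝓐).obj M)),
            (∀ (m : M.carrier) (x : M.carrier ⊗[k] H),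
              HopfAlgd.Bal.mk _ _ x = M.comod.coR m →
                HopfAlgd.coinvVal M (π m) = c.actJt M x) ∧
            (∀ (m : M.carrier) (x : M.carrier ⊗[k] H),
              HopfAlgd.Bal.mk _ _ x = M.comod.coL m →
                d.toLin m = HopfAlgd.Bal.mk (HopfAlgd.actB 𝓐 _) 𝓐.leftB
                  (TensorProduct.map π c.j x)) ∧
            adj.counit.app M ≫ d = 𝟙 _ ∧ d ≫ adj.counit.app M = 𝟙 _) ∧
        -- the inverse of the unit is `∑ w ⊗ a ↦ ∑ w θ(a)` with `θ(a) = a⁽⁰⁾ j̃(a⁽¹⁾) j(1)`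
        ∃ θ : A →ₗ[k] 𝓐.B,
          (∀ (a : A) (x : A ⊗[k] H), HopfAlgd.Bal.mk _ _ x = 𝓐.coR a →
            (θ a : A) = LinearMap.mul' k A (c.jt.lTensor A x) * c.j 1) ∧
          ∀ W : ModuleCat.{max v u} (𝓐.B)ᵐᵒᵖ,
            ∃ e : (HopfAlgd.coinvariants 𝓐).obj ((HopfAlgd.induction.{v} 𝓐).obj W) ⟶ W,
              (∀ (y : (HopfAlgd.coinvariants 𝓐).obj ((HopfAlgd.induction.{v} 𝓐).obj W))
                (x : W ⊗[k] A),
                HopfAlgd.Bal.mk (HopfAlgd.actB 𝓐 W) 𝓐.leftB x = HopfAlgd.coinvVal _ y →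
                  e y = HopfAlgd.actVia θ W x) ∧
              adj.unit.app W ≫ e = 𝟙 _ ∧ e ≫ adj.unit.app W = 𝟙 _ := by
  have hunit : ∀ W, IsIso ((HopfAlgd.inductionAdjunction.{v} 𝓐).unit.app W) := fun W =>
    ⟨hcleft.some.unitInv W, hcleft.some.unitHom_comp_unitInv W,
      hcleft.some.unitInv_comp_unitHom W⟩
  have hcounit : ∀ M, IsIso ((HopfAlgd.inductionAdjunction.{v} 𝓐).counit.app M) := fun M =>
    ⟨hcleft.some.counitInvHom M, hcleft.some.counitHom_comp_counitInvHom M,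
      hcleft.some.counitInvHom_comp_counitHom M⟩
  refine ⟨(HopfAlgd.inductionAdjunction.{v} 𝓐).toEquivalence.isEquivalence_functor,
    HopfAlgd.inductionAdjunction.{v} 𝓐, fun _ _ => rfl, fun _ _ _ => rfl, fun c => ⟨fun M => ?_, ?_⟩⟩
  · exact ⟨c.projCoinv M, c.counitInvHom M, fun m x hx => c.proj_eq hx,
      fun m x hx => c.counitInv_eq hx, c.counitHom_comp_counitInvHom M,
      c.counitInvHom_comp_counitHom M⟩
  · refine ⟨c.retraction, fun a x hx => ?_, fun W => ⟨c.unitInv W, fun y x hx => ?_,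
      c.unitHom_comp_unitInv W, c.unitInv_comp_unitHom W⟩⟩
    · rw [c.coe_retraction, c.projA_eq hx]
    · change c.unitInvLin W (HopfAlgd.coinvVal _ y) = _
      rw [← hx]
      rfl
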